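/- Let $P$ be a densely defined operator on a complex Hilbert space, positive in the sense that $\langle x,Px\rangle\ge 0$ on its domain, with $(1+P)^{-1}$ compact and everywhere defined (if $0$ is not an eigenvalue this means that $P$ has a compact inverse). Suppose that its eigenvalues are $\lambda_n=A(n)=a(n+\alpha)$, $n=0,1,2,\dots$, with $a>0$ and $\alpha\ge 0$, and that the multiplicity of $\lambda_n$ is $B(n)$, where $B$ is a polynomial (an $n$ with $B(n)=0$ contributes no eigenvalue). Then $e^{-tP}$ is trace class for every $t>0$. Put $\ell=1+\deg B$ and let $N\ge 0$ be any integer with $N+\alpha>0$ (if $\alpha>0$ one can take $N=0$). The truncated zeta function $\zeta_P^N(s)=\sum_{n\ge N}B(n)\lambda_n^{-s}$, that is, the trace of $P^{-s}$ restricted to the spectral subspace of the eigenvalues $\ge\lambda_N$, is defined for $\operatorname{Re}s>\ell$ and extends meromorphically to $\mathbb C$. The expansion $$\operatorname{Tr}e^{-tP}-\sum_{n=0}^{N-1}B(n)e^{-tA(n)}\ \sim\ \sum_{k=0}^{\infty}\varphi_k(t),\qquad \varphi_k(t)=\operatorname*{Res}_{s=\ell-k}\bigl(\Gamma(s)\,\zeta_P^N(s)\bigr)\,t^{k-\ell},$$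 holds asymptotically as $t\downarrow 0$ (the remainder after the term $k=K$ is $O(t^{K+1-\ell})$ for every $K \geq 0$), and it is absolutely exact on $(0,2\pi/a)$: on this interval $\sum_k\varphi_k(t)$ converges locally uniformly to the left-hand side, and $\sum_k|\varphi_k(t)|$ converges locally uniformly. In particular, for an operator $P_0$ of this kind with eigenvalues $1,2,3,\dots$, each of multiplicity one, the expansion (with $N=0$, $\ell=1$) is $$\operatorname{Tr}e^{-tP_0}=t^{-1}-\tfrac12+\sum_{n=0}^{\infty}\frac{B_{2n+2}}{(2n+2)!}\,t^{2n+1},\qquad 0<t<2\pi,$$ where the $B_{m}$ are the Bernoulli numbers: $\varphi_0=t^{-1}$, $\varphi_1=-\tfrac12$, $\varphi_{2n+2}(t)=\frac{B_{2n+2}}{(2n+2)!}t^{2n+1}$ and $\varphi_{2n+3}=0$ for $n\ge 0$. After omission of the vanishing terms this series is an asymptotic expansion of $\operatorname{Tr}e^{-tP_0}$ as $t\downarrow 0$ (the terms form an asymptotic scale, and each remainder is $O$ of the first omitted term), and it is absolutely exact on $(0,2\pi)$. -/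

import Mathlib

open Filter Topology Set
open scoped InnerProductSpace

universe u

namespace HeatTrace

noncomputable section

variable {H : Type u} [NormedAddCommGroup H] [InnerProductSpace ℂ H] [CompleteSpace H]

/-- `P` is a densely defined operator on the Hilbert space `H` which is positive in the sense that
`⟪x, P x⟫` is real and `≥ 0` on the domain, and whose resolvent `(1 + P)⁻¹` is an everywhere defined
compact operator. Such a `P` is self-adjoint. If moreover `0` is not an eigenvalue, this says exactly
that `P` is a positive operator with compact inverse; a finite-dimensional kernel is allowed. -/
structure IsPositiveWithCompactResolvent (P : H →ₗ.[ℂ] H) : Prop where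
  dense_domain : Dense (P.domain : Set H)
  nonneg : ∀ x : P.domain, 0 ≤ (⟪(x : H), P x⟫_ℂ).re ∧ (⟪(x : H), P x⟫_ℂ).im = 0
  compact_resolvent : ∃ K : H →L[ℂ] H, IsCompactOperator K ∧
    (∀ x : P.domain, K ((x : H) + P x) = x) ∧
    ∀ y : H, ∃ hy : K y ∈ P.domain, K y + P ⟨K y, hy⟩ = y

/-- The eigenspace `ker (P - μ)`, as a subspace of `H`. -/
def eigenspace (P : H →ₗ.[ℂ] H) (μ : ℝ) : Submodule ℂ H :=
  (LinearMap.ker (P.toFun - (μ : ℂ) • P.domain.subtype)).map P.domain.subtype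

/-- The orthogonal projection `E_μ` of `H` onto the eigenspace `ker (P - μ)`. (Eigenspaces of the
operators considered are finite-dimensional, so that taking the closure changes nothing.) -/
def spectralProjection (P : H →ₗ.[ℂ] H) (μ : ℝ) : H →L[ℂ] H :=
  (eigenspace P μ).topologicalClosure.starProjection

/-- The function `f(P) = ∑_μ f(μ) E_μ` of an operator `P` with discrete spectrum, the sum running over
the eigenvalues `μ` (all other terms vanish) and converging in operator norm, for `f` vanishing at
infinity along the spectrum. -/
def functionOf (P : H →ₗ.[ℂ] H) (f : ℝ → ℂ) : H →L[ℂ] H :=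
  ∑' μ : ℝ, f μ • spectralProjection P μ

/-- `T` is trace class with trace `c`: for every orthonormal basis `(b i)` of `H`, the sum
`∑ i, ⟪b i, T (b i)⟫` converges (absolutely) to `c`. -/
def HasTrace (T : H →L[ℂ] H) (c : ℂ) : Prop :=
  ∀ (ι : Type u) (b : HilbertBasis ι ℂ H), HasSum (fun i => ⟪b i, T (b i)⟫_ℂ) c

/-- `T` is trace class. -/
def IsTraceClass (T : H →L[ℂ] H) : Prop := ∃ c, HasTrace T c

open Classical in
/-- The trace of a trace class operator (and `0` for other operators). -/
def trace (T : H →L[ℂ] H) : ℂ := if h : IsTraceClass T then h.choose else 0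

/-- The operator `e^{-tP}`. -/
def heatOperator (P : H →ₗ.[ℂ] H) (t : ℝ) : H →L[ℂ] H :=
  functionOf P (fun μ => (Real.exp (-(t * μ)) : ℂ))

/-- The heat trace `Tr e^{-tP}`. -/
def heatTrace (P : H →ₗ.[ℂ] H) (t : ℝ) : ℂ := trace (heatOperator P t)

/-- The eigenvalues of `P` are the numbers `A(n)`, `n = 0, 1, 2, …`, and the multiplicity of the
eigenvalue `A(n)` is `B(n)`; an `n` with `B(n) = 0` contributes no eigenvalue. -/
structure HasPolynomialSpectrum (P : H →ₗ.[ℂ] H) (A B : Polynomial ℝ) : Prop where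
  eigenvalue : ∀ μ : ℝ, eigenspace P μ ≠ ⊥ → ∃ n : ℕ, μ = A.eval (n : ℝ)
  finite : ∀ n : ℕ, Module.Finite ℂ (eigenspace P (A.eval (n : ℝ)))
  multiplicity : ∀ n : ℕ,
    (Module.finrank ℂ (eigenspace P (A.eval (n : ℝ))) : ℝ) = B.eval (n : ℝ)

open Classical in
/-- The complex power `P^{-s}` restricted to the spectral subspace of the eigenvalues `≥ c`. If
all eigenvalues are `≥ c > 0`, this is `P^{-s}` itself. -/
def truncatedPower (P : H →ₗ.[ℂ] H) (c : ℝ) (s : ℂ) : H →L[ℂ] H :=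
  functionOf P (fun μ => if c ≤ μ then (μ : ℂ) ^ (-s) else 0)

/-- `Z` is a meromorphic function on the whole plane which extends the (truncated) spectral zeta
function `s ↦ Tr (P^{-s})`, where only eigenvalues `≥ c` are taken into account, from a half-plane
`Re s > ℓ` in which the operators `P^{-s}` are trace class. -/
structure IsZetaContinuation (P : H →ₗ.[ℂ] H) (c : ℝ) (ℓ : ℕ) (Z : ℂ → ℂ) : Prop where
  meromorphic : ∀ s : ℂ, MeromorphicAt Z s
  traceClass : ∀ s : ℂ, (ℓ : ℝ) < s.re → IsTraceClass (truncatedPower P c s)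
  extends_zeta : ∀ s : ℂ, (ℓ : ℝ) < s.re → Z s = trace (truncatedPower P c s)

/-- The residue at `z₀` of a function with an isolated singularity there: the value of
`(2πi)⁻¹ ∮ f(z) dz` over all small circles around `z₀`. -/
def residue (f : ℂ → ℂ) (z₀ : ℂ) : ℂ :=
  limUnder (𝓝[>] (0 : ℝ)) fun r => (2 * Real.pi * Complex.I)⁻¹ * ∮ z in C(z₀, r), f z

/-- The term `Res_{s = ℓ - k} (Γ(s) Z(s)) · t^{-(ℓ - k)}`. -/
def expansionTerm (Z : ℂ → ℂ) (ℓ k : ℕ) (t : ℝ) : ℂ :=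
  residue (fun s => Complex.Gamma s * Z s) ((ℓ : ℂ) - (k : ℂ)) * (t : ℂ) ^ ((k : ℤ) - (ℓ : ℤ))

/-- `∑ k, φ k` is an asymptotic expansion of `f` as `t ↓ 0` with respect to the asymptotic scale
`g`. For `g = φ` this means that `φ` is itself an asymptotic scale; a separate `g` is needed if some
terms `φ k` vanish identically. -/
def IsAsymptoticExpansion (f : ℝ → ℂ) (φ g : ℕ → ℝ → ℂ) : Prop :=
  (∀ n, g (n + 1) =o[𝓝[>] 0] g n) ∧ (∀ n, φ n =O[𝓝[>] 0] g n) ∧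
    ∀ N, (fun t => f t - ∑ k ∈ Finset.range (N + 1), φ k t) =O[𝓝[>] 0] g (N + 1)

/-- `∑ k, φ k` is an absolutely exact expansion of `f` on `(0, T)`: the series converges to `f`,
locally uniformly on `(0, T)`, and the series `∑ k, |φ k|` converges locally uniformly on `(0, T)`. -/
def IsAbsolutelyExact (f : ℝ → ℂ) (φ : ℕ → ℝ → ℂ) (T : ℝ) : Prop :=
  TendstoLocallyUniformlyOn (fun n t => ∑ k ∈ Finset.range n, φ k t) f atTop (Ioo 0 T) ∧
    ∃ G : ℝ → ℝ,
      TendstoLocallyUniformlyOn (fun n t => ∑ k ∈ Finset.range n, ‖φ k t‖) G atTop (Ioo 0 T)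

/-- The sequence `t⁻¹, -1/2, B₂/2! t, B₄/4! t³, B₆/6! t⁵, …` with `B_n` the Bernoulli numbers. -/
def bernoulliTerm : ℕ → ℝ → ℂ
  | 0, t => (t : ℂ)⁻¹
  | 1, _ => -1 / 2
  | n + 2, t =>
      ((bernoulli (2 * n + 2) : ℚ) : ℂ) / ((Nat.factorial (2 * n + 2) : ℕ) : ℂ) *
        (t : ℂ) ^ (2 * n + 1)

end

end HeatTrace

/-! With `β = N + α > 0`, the heat trace without its first `N` terms is `h(t) = ∑ B(n + N) e^{-ta(n
+ β)}`. In the basis `(n + j).choose j` of polynomials in `n`, the negative binomial series turns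
`h` into a finite combination of `e^{-aβt} / (1 - e^{-at})^{j + 1}` with `j + 1 ≤ ℓ`. The zeros of
`1 - e^{-at}` are the points of `(2πi/a)ℤ`, so `t^ℓ h(t)` is holomorphic for `|t| < 2π/a`. Its
Taylor series `∑ c_k t^k`, divided by `t^ℓ`, gives both the asymptotic and the absolutely exact
expansion.

It remains to see that `c_k` is a residue. For `Re s > ℓ` the Mellin transform of `h` is `Γ(s)
ζ(s)`, with `ζ` the truncated zeta function. Cut the integral at some `r < 2π/a`. The part over `(r,
∞)` is entire by exponential decay, and the part over `(0, r]` is `∑ c_k r^{s - ℓ + k} / (s - ℓ +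
k)`, with simple poles at `ℓ - k` of residue `c_k` (`exists_meromorphic_mellin`). Dividing by `Γ`
continues `ζ`.

For `P₀` one has `h(t) = 1 / (e^t - 1)`, the generating function of the Bernoulli numbers divided by
`t`. -/

namespace HeatTrace

/-! ### Traces of functions of `P` -/

section Trace

variable {H : Type u} [NormedAddCommGroup H] [InnerProductSpace ℂ H]

/-- The projection is a sum of rank-one projections onto the vectors of an orthonormal basis of `V`.
By Parseval each contributes `1`. -/
lemma hasSum_inner_starProjection {ι : Type*} (b : HilbertBasis ι ℂ H) (V : Submodule ℂ H)
    [FiniteDimensional ℂ V] [V.HasOrthogonalProjection] :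
    HasSum (fun i => ⟪b i, V.starProjection (b i)⟫_ℂ) (Module.finrank ℂ V : ℂ) := by
  set e := stdOrthonormalBasis ℂ V
  have h1 : ∀ i, ⟪b i, V.starProjection (b i)⟫_ℂ =
      ∑ j, ⟪((e j : V) : H), b i⟫_ℂ * ⟪b i, ((e j : V) : H)⟫_ℂ := by
    intro i
    rw [e.starProjection_eq_sum_rankOne]
    simp
  simp_rw [h1]
  have h2 : (Module.finrank ℂ V : ℂ) =
      ∑ j : Fin (Module.finrank ℂ V), ⟪((e j : V) : H), ((e j : V) : H)⟫_ℂ := by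
    have : ∀ j, ⟪((e j : V) : H), ((e j : V) : H)⟫_ℂ = 1 := by
      intro j
      rw [← Submodule.coe_inner, inner_self_eq_norm_sq_to_K, e.orthonormal.1 j]
      simp
    simp_rw [this]
    simp
  rw [h2]
  exact hasSum_sum fun j _ => b.hasSum_inner_mul_inner _ _

lemma inner_starProjection_self (V : Submodule ℂ H) [V.HasOrthogonalProjection] (x : H) :
    ⟪x, V.starProjection x⟫_ℂ = ((‖V.starProjection x‖ ^ 2 : ℝ) : ℂ) := by
  have h := V.inner_starProjection_left_eq_right x (V.starProjection x)
  rw [V.starProjection_eq_self_iff.2 (V.starProjection_apply_mem x),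
    inner_self_eq_norm_sq_to_K] at h
  rw [← h]
  simp

variable [CompleteSpace H]

lemma trace_eq_of_hasTrace {T : H →L[ℂ] H} {c : ℂ} (h : HasTrace T c) : trace T = c := by
  have hT : IsTraceClass T := ⟨c, h⟩
  obtain ⟨w, b, -⟩ := exists_hilbertBasis ℂ H
  rw [trace, dif_pos hT]
  exact (hT.choose_spec _ b).unique (h _ b)

/-- The weights `‖c n‖ * finrank (V n)` dominate the operator norms. They are also the row sums of
the absolute values of the double family indexed by `n` and the basis vectors, because diagonal
entries of projections are nonnegative. Hence Fubini allows summing over `n` first. -/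
lemma hasTrace_tsum_starProjection (V : ℕ → Submodule ℂ H) [∀ n, FiniteDimensional ℂ (V n)]
    [∀ n, (V n).HasOrthogonalProjection] (c : ℕ → ℂ)
    (hc : Summable fun n => ‖c n‖ * Module.finrank ℂ (V n)) :
    Summable (fun n => c n • (V n).starProjection) ∧
    HasTrace (∑' n, c n • (V n).starProjection) (∑' n, c n * Module.finrank ℂ (V n)) := by
  have hs : Summable (fun n => c n • (V n).starProjection) := by
    refine Summable.of_norm_bounded hc fun n => ?_
    rw [norm_smul]
    refine mul_le_mul_of_nonneg_left ?_ (norm_nonneg _)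
    -- A projection has norm at most `1`, which the rank dominates unless it is `0`; then the
    -- projection vanishes.
    rcases Nat.eq_zero_or_pos (Module.finrank ℂ (V n)) with h | h
    · have : V n = ⊥ := Submodule.finrank_eq_zero.1 h
      have h0 : (V n).starProjection = 0 := by
        ext x
        have := (V n).starProjection_apply_mem x
        simp_all
      simp [h0]
    · exact ((V n).starProjection_norm_le).trans (by exact_mod_cast h)
  refine ⟨hs, fun ι b => ?_⟩
  have h1 : ∀ i, ⟪b i, (∑' n, c n • (V n).starProjection) (b i)⟫_ℂ =
      ∑' n, c n * ⟪b i, (V n).starProjection (b i)⟫_ℂ := by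
    intro i
    have h2 := ((ContinuousLinearMap.apply ℂ H (b i)).hasSum hs.hasSum)
    have h3 := ((innerSL ℂ (b i)).hasSum h2)
    refine (HasSum.tsum_eq h3).symm.trans (tsum_congr fun n => ?_)
    simp
  simp_rw [h1]
  have hnorm : ∀ n, HasSum (fun i => ‖c n * ⟪b i, (V n).starProjection (b i)⟫_ℂ‖)
      (‖c n‖ * Module.finrank ℂ (V n)) := by
    intro n
    simp_rw [norm_mul]
    refine HasSum.mul_left _ ?_
    have := hasSum_inner_starProjection b (V n)
    simp_rw [inner_starProjection_self] at this ⊢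
    have h4 : HasSum (fun i => ‖(V n).starProjection (b i)‖ ^ 2)
        (Module.finrank ℂ (V n) : ℝ) := by
      rw [← Complex.ofReal_natCast] at this
      exact Complex.hasSum_ofReal.1 this
    refine h4.congr_fun fun i => ?_
    rw [Complex.norm_real, norm_pow, norm_norm]
  have hsum : Summable fun p : ℕ × ι => c p.1 * ⟪b p.2, (V p.1).starProjection (b p.2)⟫_ℂ := by
    refine Summable.of_norm ?_
    rw [summable_prod_of_nonneg fun _ => norm_nonneg _]
    exact ⟨fun n => (hnorm n).summable, hc.congr fun n => (hnorm n).tsum_eq.symm⟩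
  have hcol : HasSum (fun p : ℕ × ι => c p.1 * ⟪b p.2, (V p.1).starProjection (b p.2)⟫_ℂ)
      (∑' n, c n * Module.finrank ℂ (V n)) := by
    have := hsum.hasSum
    rw [hsum.tsum_prod] at this
    convert this using 1
    refine tsum_congr fun n => ?_
    exact (((hasSum_inner_starProjection b (V n)).mul_left (c n)).tsum_eq).symm
  have hswap := (Equiv.prodComm ι ℕ).hasSum_iff.2 hcol
  exact hswap.prod_fiberwise fun i => (hswap.summable.prod_factor i).hasSum

/-- The trace of `f(P)` is the sum of the values of `f` at the eigenvalues, with multiplicities. -/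
lemma hasTrace_functionOf {P : H →ₗ.[ℂ] H} {A B : Polynomial ℝ}
    (hP : HasPolynomialSpectrum P A B) (hA : Function.Injective fun n : ℕ => A.eval (n : ℝ))
    (f : ℝ → ℂ)
    (hf : Summable fun n : ℕ => ‖f (A.eval (n : ℝ)) * (B.eval (n : ℝ) : ℝ)‖) :
    HasTrace (functionOf P f) (∑' n : ℕ, f (A.eval (n : ℝ)) * (B.eval (n : ℝ) : ℝ)) := by
  have hcl : ∀ n : ℕ, (eigenspace P (A.eval (n : ℝ))).topologicalClosure =
      eigenspace P (A.eval (n : ℝ)) := fun n => by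
    have := hP.finite n
    exact (Submodule.closed_of_finiteDimensional _).submodule_topologicalClosure_eq
  have : ∀ n : ℕ, FiniteDimensional ℂ (eigenspace P (A.eval (n : ℝ))).topologicalClosure :=
    fun n => by rw [hcl]; exact hP.finite n
  have hrank : ∀ n : ℕ,
      ((Module.finrank ℂ (eigenspace P (A.eval (n : ℝ))).topologicalClosure : ℕ) : ℝ) =
        B.eval (n : ℝ) := fun n => by rw [hcl]; exact hP.multiplicity n
  have hrank' : ∀ n : ℕ,
      ((Module.finrank ℂ (eigenspace P (A.eval (n : ℝ))).topologicalClosure : ℕ) : ℂ) =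
        (B.eval (n : ℝ) : ℝ) := fun n => by rw [← hrank]; simp
  obtain ⟨-, h2⟩ := hasTrace_tsum_starProjection
    (fun n : ℕ => (eigenspace P (A.eval (n : ℝ))).topologicalClosure)
    (fun n => f (A.eval (n : ℝ))) (by
      refine hf.congr fun n => ?_
      rw [norm_mul, ← hrank']
      simp)
  simp_rw [hrank'] at h2
  convert h2 using 1
  -- `functionOf` sums over all real `μ`, but the projection is zero off the range of `n ↦ A(n)`.
  refine (hA.tsum_eq fun μ hμ => ?_).symm
  by_contra hne
  have hbot : eigenspace P μ = ⊥ := by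
    by_contra h
    obtain ⟨n, hn⟩ := hP.eigenvalue μ h
    exact hne ⟨n, hn.symm⟩
  refine hμ ?_
  have : spectralProjection P μ = 0 := by
    ext x
    have hm := (eigenspace P μ).topologicalClosure.starProjection_apply_mem x
    have hb : (eigenspace P μ).topologicalClosure = ⊥ := by
      rw [hbot]
      exact isClosed_singleton.submodule_topologicalClosure_eq
    rw [spectralProjection]
    generalize (eigenspace P μ).topologicalClosure.starProjection x = y at hm
    rw [hb] at hm
    simpa using hm
  simp [this]

end Trace

/-! ### Closed form and Laurent expansion of the heat sum -/

section HeatSum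

open Polynomial in
/-- A polynomial of degree at most `d` is a combination of the binomial coefficients
`(n + j).choose j` with `j ≤ d`. -/
lemma exists_eval_eq_sum_choose (d : ℕ) (B : Polynomial ℝ) (hB : B.natDegree ≤ d) :
    ∃ b : ℕ → ℝ, ∀ n : ℕ, B.eval (n : ℝ) =
      ∑ j ∈ Finset.range (d + 1), b j * ((n + j).choose j : ℝ) := by
  induction d generalizing B with
  | zero =>
    refine ⟨fun _ => B.coeff 0, fun n => ?_⟩
    rw [Polynomial.eq_C_of_natDegree_le_zero hB]
    simp
  | succ d ih =>
    -- `q = (X + 1)⋯(X + d + 1)` is monic of degree `d + 1`, so subtracting a multiple of it removes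
    -- the top coefficient of `B`.
    set q : Polynomial ℝ := (ascPochhammer ℝ (d + 1)).comp (X + C 1)
    have hq : q.natDegree = d + 1 := by
      rw [natDegree_comp, ascPochhammer_natDegree, natDegree_X_add_C, mul_one]
    have hq1 : q.coeff (d + 1) = 1 := by
      have : q.Monic := (monic_ascPochhammer ℝ (d + 1)).comp (monic_X_add_C 1) (by
        rw [natDegree_X_add_C]; exact one_ne_zero)
      rw [← hq]; exact this
    have hqe : ∀ n : ℕ, q.eval (n : ℝ) = (d + 1).factorial * ((n + (d + 1)).choose (d + 1) : ℝ) := by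
      intro n
      have h := ascPochhammer_nat_eq_natCast_ascFactorial ℝ (n + 1) (d + 1)
      rw [Nat.ascFactorial_eq_factorial_mul_choose] at h
      simp only [q, eval_comp, eval_add, eval_X, eval_C]
      push_cast at h
      rw [h]
    obtain ⟨b, hb⟩ := ih (B - C (B.coeff (d + 1)) * q) (by
      rw [Polynomial.natDegree_le_iff_coeff_eq_zero]
      intro m hm
      rcases Nat.lt_or_ge (d + 1) m with h | h
      · simp [coeff_eq_zero_of_natDegree_lt (hB.trans_lt h),
          coeff_eq_zero_of_natDegree_lt (hq.trans_lt h)]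
      · obtain rfl : m = d + 1 := by omega
        simp [hq1])
    refine ⟨Function.update b (d + 1) (B.coeff (d + 1) * (d + 1).factorial), fun n => ?_⟩
    rw [Finset.sum_range_succ, Function.update_self]
    have h2 : ∑ j ∈ Finset.range (d + 1), Function.update b (d + 1)
        (B.coeff (d + 1) * (d + 1).factorial) j * ((n + j).choose j : ℝ) =
        (B - C (B.coeff (d + 1)) * q).eval (n : ℝ) := by
      rw [hb]
      refine Finset.sum_congr rfl fun j hj => ?_
      rw [Function.update_of_ne (by simp at hj; omega)]
    rw [h2]
    simp [hqe]
    ring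

/-- The closed form of `∑ n, (∑ j, b j * (n + j).choose j) * exp (-(a * (n + β) * z))`. -/
noncomputable def expRational (b : ℕ → ℝ) (d : ℕ) (a β : ℝ) (z : ℂ) : ℂ :=
  ∑ j ∈ Finset.range (d + 1),
    b j * (Complex.exp (-(a * β * z)) / (1 - Complex.exp (-(a * z))) ^ (j + 1))

lemma hasSum_expRational (b : ℕ → ℝ) (d : ℕ) {a β t : ℝ} (ha : 0 < a) (ht : 0 < t) :
    HasSum (fun n : ℕ => ((∑ j ∈ Finset.range (d + 1), b j * ((n + j).choose j : ℝ) : ℝ) : ℂ) *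
      (Real.exp (-(t * (a * (n + β)))) : ℝ)) (expRational b d a β t) := by
  have hr : ‖Complex.exp (-(a * t))‖ < 1 := by
    rw [Complex.norm_exp]
    simpa using mul_pos ha ht
  have h := hasSum_sum (s := Finset.range (d + 1)) fun j _ =>
    ((hasSum_choose_mul_geometric_of_norm_lt_one j hr).mul_left
      (Complex.exp (-(a * β * t)))).mul_left (b j : ℂ)
  simp only [mul_one_div] at h
  refine h.congr_fun fun n => ?_
  · push_cast
    rw [Finset.sum_mul]
    refine Finset.sum_congr rfl fun j _ => ?_
    have : Complex.exp (-(t * (a * (n + β)))) =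
        Complex.exp (-(a * β * t)) * Complex.exp (-(a * t)) ^ n := by
      rw [← Complex.exp_nat_mul, ← Complex.exp_add]
      ring_nf
    rw [this]
    ring

/-- The zeros are `2πin/a` with `n` an integer. This is where the radius `2π/a` comes from. -/
lemma one_sub_exp_ne_zero {a : ℝ} (ha : 0 < a) {z : ℂ} (hz : ‖z‖ < 2 * Real.pi / a)
    (h0 : z ≠ 0) : 1 - Complex.exp (-(a * z)) ≠ 0 := by
  intro h
  have h1 : Complex.exp (-(a * z)) = 1 := (sub_eq_zero.1 h).symm
  obtain ⟨n, hn⟩ := Complex.exp_eq_one_iff.1 h1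
  have hnorm := congrArg norm hn
  rw [lt_div_iff₀ ha] at hz
  simp [abs_of_pos ha, abs_of_pos Real.pi_pos] at hnorm
  have hn0 : n ≠ 0 := by
    rintro rfl
    simp [ha.ne', h0] at hn
  have : (1 : ℝ) ≤ |(n : ℝ)| := by exact_mod_cast Int.one_le_abs hn0
  nlinarith [Real.pi_pos]

/-- `t ^ (d + 1)` times the heat sum extends holomorphically across `0`. -/
lemma exists_differentiableOn_expRational (b : ℕ → ℝ) (d : ℕ) {a : ℝ} (β : ℝ) (ha : 0 < a) :
    ∃ g : ℂ → ℂ, DifferentiableOn ℂ g (Metric.ball 0 (2 * Real.pi / a)) ∧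
      ∀ z ∈ Metric.ball (0 : ℂ) (2 * Real.pi / a), z ≠ 0 →
        g z = z ^ (d + 1) * expRational b d a β z := by
  set U := Metric.ball (0 : ℂ) (2 * Real.pi / a)
  have hU : U ∈ 𝓝 (0 : ℂ) := Metric.ball_mem_nhds _ (by positivity)
  set f : ℂ → ℂ := fun z => 1 - Complex.exp (-(a * z))
  have hf : Differentiable ℂ f := by fun_prop
  -- `dslope f 0` is `(1 - e^{-az}) / z`, continued by the value `a` at `0`. It has no zero in the
  -- disc, so its inverse powers are holomorphic there.
  have hD : DifferentiableOn ℂ (dslope f 0) U :=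
    (Complex.differentiableOn_dslope hU).2 hf.differentiableOn
  have hd0 : ∀ z ∈ U, z ≠ 0 → dslope f 0 z = f z / z := by
    intro z _ h
    rw [dslope_of_ne _ h, slope_def_field]
    simp [f]
  have hne : ∀ z ∈ U, dslope f 0 z ≠ 0 := by
    intro z hz
    by_cases h : z = 0
    · rw [h, dslope_same]
      have : HasDerivAt f (a : ℂ) 0 := by
        have h1 : HasDerivAt (fun z : ℂ => -(a * z)) (-(a * 1)) 0 :=
          ((hasDerivAt_id (0 : ℂ)).const_mul (a : ℂ)).neg
        have h2 := (h1.cexp).const_sub 1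
        simpa using h2
      rw [this.deriv]
      exact_mod_cast ha.ne'
    · rw [hd0 z hz h]
      exact div_ne_zero (one_sub_exp_ne_zero ha (by simpa [U] using hz) h) h
  refine ⟨fun z => ∑ j ∈ Finset.range (d + 1), b j * (Complex.exp (-(a * β * z)) * z ^ (d - j) *
    ((dslope f 0 z)⁻¹) ^ (j + 1)), ?_, ?_⟩
  · refine DifferentiableOn.fun_sum fun j _ => DifferentiableOn.const_mul ?_ _
    refine DifferentiableOn.mul (by fun_prop) ((hD.inv hne).pow _)
  · intro z hz h
    rw [expRational, Finset.mul_sum]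
    refine Finset.sum_congr rfl fun j hj => ?_
    rw [hd0 z hz h]
    have hfz : f z ≠ 0 := one_sub_exp_ne_zero ha (by simpa [U] using hz) h
    have hjd : d + 1 = (d - j) + (j + 1) := by simp at hj; omega
    rw [show z ^ (d + 1) = z ^ (d - j) * z ^ (j + 1) by rw [← pow_add, ← hjd], inv_div, div_pow]
    simp only [f] at hfz ⊢
    field_simp

/-- The Laurent expansion of the heat sum at `0`. -/
lemma exists_hasSum_expRational (b : ℕ → ℝ) (d : ℕ) {a : ℝ} (β : ℝ) (ha : 0 < a) :
    ∃ c : ℕ → ℂ, ∀ z ∈ Metric.ball (0 : ℂ) (2 * Real.pi / a), z ≠ 0 →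
      HasSum (fun k => c k * z ^ k) (z ^ (d + 1) * expRational b d a β z) := by
  obtain ⟨g, hg, hgz⟩ := exists_differentiableOn_expRational b d β ha
  refine ⟨fun n => (n.factorial : ℂ)⁻¹ * iteratedDeriv n g 0, fun z hz h => ?_⟩
  have := Complex.hasSum_taylorSeries_on_ball hg hz
  rw [hgz z hz h] at this
  refine this.congr_fun fun k => ?_
  simp only [sub_zero, smul_eq_mul]
  ring

lemma continuousOn_expRational (b : ℕ → ℝ) (d : ℕ) {a : ℝ} (β : ℝ) (ha : 0 < a) :
    ContinuousOn (fun t : ℝ => expRational b d a β t) (Ioi 0) := by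
  unfold expRational
  refine continuousOn_finsetSum _ fun j _ => ContinuousOn.mul continuousOn_const ?_
  refine ContinuousOn.div (by fun_prop) (by fun_prop) fun t ht => pow_ne_zero _ ?_
  intro h
  have h1 : Complex.exp (-(a * t)) = 1 := (sub_eq_zero.1 h).symm
  have : ‖Complex.exp (-(a * t))‖ < 1 := by
    rw [Complex.norm_exp]
    simpa using mul_pos ha ht
  simp [h1] at this

/-- The denominators tend to `1`, so the numerators `e^{-aβt}` set the decay. -/
lemma expRational_isBigO (b : ℕ → ℝ) (d : ℕ) {a : ℝ} (β : ℝ) (ha : 0 < a) :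
    (fun t : ℝ => expRational b d a β t) =O[atTop] fun t => Real.exp (-(a * β) * t) := by
  unfold expRational
  refine Asymptotics.IsBigO.fun_sum fun j _ => Asymptotics.IsBigO.const_mul_left ?_ (b j : ℂ)
  have h1 : Tendsto (fun t : ℝ => Complex.exp (-(a * t))) atTop (𝓝 0) := by
    rw [tendsto_zero_iff_norm_tendsto_zero]
    simp only [Complex.norm_exp, Complex.neg_re, Complex.mul_re, Complex.ofReal_re,
      Complex.ofReal_im, mul_zero, sub_zero]
    exact Real.tendsto_exp_neg_atTop_nhds_zero.comp (tendsto_id.const_mul_atTop ha)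
  have h2 : Tendsto (fun t : ℝ => ((1 - Complex.exp (-(a * t))) ^ (j + 1))⁻¹) atTop (𝓝 1) := by
    have := ((h1.const_sub 1).pow (j + 1)).inv₀ (by simp)
    simpa using this
  have h3 : (fun t : ℝ => Complex.exp (-(a * β * t))) =O[atTop]
      fun t => Real.exp (-(a * β) * t) := by
    refine Asymptotics.IsBigO.of_bound 1 (Eventually.of_forall fun t => ?_)
    rw [Complex.norm_exp, Real.norm_eq_abs, Real.abs_exp]
    simp
  simpa [div_eq_mul_inv] using h3.mul (h2.isBigO_one ℝ)

end HeatSum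

/-! ### Residue at a simple pole -/

section Residue

/-- On every small circle the polar part integrates to `2πi p` and Cauchy's theorem kills `G`, so
the limit is of an eventually constant function. -/
lemma residue_eq {f G : ℂ → ℂ} {z₀ p : ℂ} (hG : AnalyticAt ℂ G z₀)
    (hf : ∀ᶠ z in 𝓝[≠] z₀, f z = p / (z - z₀) + G z) : residue f z₀ = p := by
  obtain ⟨ε, hε, hball⟩ := Metric.eventually_nhds_iff_ball.1
    ((eventually_nhdsWithin_iff.1 hf).and hG.eventually_analyticAt)
  refine Tendsto.limUnder_eq (tendsto_const_nhds.congr' ?_)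
  filter_upwards [Ioo_mem_nhdsGT hε] with r hr
  have hsub : Metric.closedBall z₀ r ⊆ Metric.ball z₀ ε := Metric.closedBall_subset_ball hr.2
  have hGd : DifferentiableOn ℂ G (Metric.closedBall z₀ r) := fun z hz =>
    (hball z (hsub hz)).2.differentiableAt.differentiableWithinAt
  have hcongr : (∮ z in C(z₀, r), f z) = ∮ z in C(z₀, r), (p * (z - z₀)⁻¹ + G z) := by
    refine circleIntegral.integral_congr hr.1.le fun z hz => ?_
    rw [(hball z (hsub (Metric.sphere_subset_closedBall hz))).1
      (Metric.ne_of_mem_sphere hz hr.1.ne'), div_eq_mul_inv]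
  have h1 : CircleIntegrable (fun z => p * (z - z₀)⁻¹) z₀ r := by
    refine ContinuousOn.circleIntegrable hr.1.le fun z hz => ?_
    have : z - z₀ ≠ 0 := sub_ne_zero.2 (Metric.ne_of_mem_sphere hz hr.1.ne')
    exact (continuousAt_const.mul ((continuousAt_id.sub continuousAt_const).inv₀
      this)).continuousWithinAt
  have h2 : CircleIntegrable G z₀ r :=
    (hGd.continuousOn.mono Metric.sphere_subset_closedBall).circleIntegrable hr.1.le
  have h3 : (∮ z in C(z₀, r), G z) = 0 :=
    Complex.circleIntegral_eq_zero_of_differentiable_on_off_countable hr.1.le countable_empty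
      hGd.continuousOn fun z hz =>
        (hball z (hsub (Metric.ball_subset_closedBall hz.1))).2.differentiableAt
  rw [hcongr, circleIntegral.integral_add h1 h2, h3, circleIntegral.integral_const_mul,
    circleIntegral.integral_sub_center_inv z₀ hr.1.ne', add_zero]
  have : (2 * Real.pi * Complex.I : ℂ) ≠ 0 := by simp [Real.pi_ne_zero]
  field_simp

end Residue

/-! ### Remainder estimates for Laurent series at `0` -/

section PowerSeries

lemma summable_norm_of_hasSum {c : ℕ → ℂ} {ℓ : ℕ} {h : ℝ → ℂ} {R r : ℝ}
    (hc : ∀ t : ℝ, 0 < t → t < R → HasSum (fun k => c k * (t : ℂ) ^ k) ((t : ℂ) ^ ℓ * h t))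
    (hr : 0 < r) (hrR : r < R) : Summable fun k => ‖c k‖ * r ^ k := by
  have := (hc r hr hrR).summable.norm
  simpa [abs_of_pos hr] using this

/-- The factor `t ^ n` comes out of the tail, and what is left is largest at `t = r`, where the
series converges absolutely. -/
lemma norm_sub_sum_le {c : ℕ → ℂ} {ℓ : ℕ} {h : ℝ → ℂ} {R r t : ℝ}
    (hc : ∀ t : ℝ, 0 < t → t < R → HasSum (fun k => c k * (t : ℂ) ^ k) ((t : ℂ) ^ ℓ * h t))
    (hrR : r < R) (ht : 0 < t) (htr : t ≤ r) (n : ℕ) :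
    ‖(t : ℂ) ^ ℓ * h t - ∑ k ∈ Finset.range n, c k * (t : ℂ) ^ k‖ ≤
      (∑' k, ‖c (k + n)‖ * r ^ k) * t ^ n := by
  have hr : 0 < r := ht.trans_le htr
  have h1 := (hasSum_nat_add_iff' n).2 (hc t ht (htr.trans_lt hrR))
  have hs : Summable fun k => ‖c (k + n)‖ * r ^ k := by
    have h2 := ((summable_nat_add_iff n).2 (summable_norm_of_hasSum hc hr hrR)).mul_right
      (r ^ n)⁻¹
    refine h2.congr fun k => ?_
    rw [pow_add]
    field_simp
  rw [← h1.tsum_eq]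
  refine tsum_of_norm_bounded (hs.hasSum.mul_right (t ^ n)) fun k => ?_
  rw [norm_mul, norm_pow, Complex.norm_real, Real.norm_of_nonneg ht.le, pow_add, ← mul_assoc]
  gcongr

lemma isBigO_sub_sum {c : ℕ → ℂ} {ℓ : ℕ} {h : ℝ → ℂ} {R : ℝ} (hR : 0 < R)
    (hc : ∀ t : ℝ, 0 < t → t < R → HasSum (fun k => c k * (t : ℂ) ^ k) ((t : ℂ) ^ ℓ * h t))
    (n : ℕ) :
    (fun t : ℝ => h t - ∑ k ∈ Finset.range n, c k * (t : ℂ) ^ ((k : ℤ) - (ℓ : ℤ)))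
      =O[𝓝[>] 0] fun t : ℝ => (t : ℂ) ^ ((n : ℤ) - (ℓ : ℤ)) := by
  refine Asymptotics.IsBigO.of_bound (∑' k, ‖c (k + n)‖ * (R / 2) ^ k) ?_
  filter_upwards [Ioo_mem_nhdsGT (half_pos hR)] with t ht
  have ht0 : (t : ℂ) ≠ 0 := by exact_mod_cast ht.1.ne'
  have hb := norm_sub_sum_le hc (half_lt_self hR) ht.1 ht.2.le n
  have heq : h t - ∑ k ∈ Finset.range n, c k * (t : ℂ) ^ ((k : ℤ) - (ℓ : ℤ)) =
      ((t : ℂ) ^ ℓ * h t - ∑ k ∈ Finset.range n, c k * (t : ℂ) ^ k) / (t : ℂ) ^ ℓ := by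
    rw [sub_div, Finset.sum_div]
    congr 1
    · field_simp
    · refine Finset.sum_congr rfl fun k _ => ?_
      rw [zpow_sub₀ ht0, zpow_natCast, zpow_natCast, mul_div_assoc]
  rw [heq, norm_div, zpow_sub₀ ht0, norm_div, zpow_natCast, zpow_natCast, ← mul_div_assoc]
  gcongr
  refine hb.trans_eq ?_
  rw [norm_pow, Complex.norm_real, Real.norm_of_nonneg ht.1.le]

end PowerSeries

/-! ### Mellin transform and its continuation -/

section Mellin

open MeasureTheory

/-- Around each integer `n` the series `∑ k, u k / (s - ℓ + k)` is the sum of a simple polar part and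
of a holomorphic function. -/
lemma exists_differentiableOn_tsum_div {u : ℕ → ℂ} (hu : Summable fun k => ‖u k‖) (ℓ : ℕ) (n : ℤ) :
    ∃ G : ℂ → ℂ, DifferentiableOn ℂ G {s | |s.re - n| < 3 / 4} ∧
      ∀ s ∈ {s : ℂ | |s.re - n| < 3 / 4}, ∑' k, u k / (s - ℓ + k) =
        (∑' k : ℕ, if (ℓ : ℤ) - k = n then u k else 0) / (s - n) + G s := by
  -- Half-width `3/4` exceeds `1/2`, so such strips around the integers cover the plane, and every
  -- integer other than `n` stays at distance at least `1/4` from this one. Hence the M-test bound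
  -- `4 * ‖u k‖`. At most one index, `k = ℓ - n`, contributes a pole.
  set U := {s : ℂ | |s.re - n| < 3 / 4}
  have hU : IsOpen U :=
    isOpen_lt (continuous_abs.comp (Complex.continuous_re.sub continuous_const)) continuous_const
  have hge : ∀ k : ℕ, (ℓ : ℤ) - k ≠ n → ∀ s ∈ U, 1 / 4 ≤ ‖s - ℓ + k‖ := by
    intro k hk s hs
    have h1 := Complex.abs_re_le_norm (s - ℓ + k)
    simp only [Complex.add_re, Complex.sub_re, Complex.natCast_re] at h1
    have h2 : (1 : ℝ) ≤ |((n - (ℓ - k) : ℤ) : ℝ)| := by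
      exact_mod_cast Int.one_le_abs (sub_ne_zero.2 hk.symm)
    have h3 : ((n - (ℓ - k) : ℤ) : ℝ) = (s.re - ℓ + k) - (s.re - n) := by push_cast; ring
    rw [h3] at h2
    have h4 := abs_sub (s.re - ℓ + k) (s.re - n)
    have h5 : |s.re - n| < 3 / 4 := hs
    linarith
  have hle : ∀ (k : ℕ), ∀ s ∈ U,
      ‖if (ℓ : ℤ) - k = n then 0 else u k / (s - ℓ + k)‖ ≤ 4 * ‖u k‖ := by
    intro k s hs
    split_ifs with hk
    · simp
    · have := hge k hk s hs
      rw [norm_div, div_le_iff₀ (by linarith)]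
      nlinarith [norm_nonneg (u k)]
  refine ⟨fun s => ∑' k : ℕ, if (ℓ : ℤ) - k = n then 0 else u k / (s - ℓ + k), ?_, ?_⟩
  · refine Complex.differentiableOn_tsum_of_summable_norm (hu.mul_left 4) (fun k => ?_) hU hle
    by_cases hk : (ℓ : ℤ) - k = n
    · simp only [hk, if_true]
      exact differentiableOn_const _
    · simp only [hk, if_false]
      refine DifferentiableOn.div (by fun_prop) (by fun_prop) fun s hs h0 => ?_
      have := hge k hk s hs
      rw [h0, norm_zero] at this
      norm_num at this
  · intro s hs
    have h1 : Summable fun k : ℕ => if (ℓ : ℤ) - k = n then u k / (s - n) else 0 := by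
      refine Summable.of_norm_bounded (hu.mul_right ‖s - n‖⁻¹) fun k => ?_
      split_ifs
      · rw [norm_div, div_eq_mul_inv]
      · rw [norm_zero]; positivity
    rw [← tsum_div_const]
    simp_rw [ite_div, zero_div]
    rw [← h1.tsum_add (Summable.of_norm_bounded (hu.mul_left 4) fun k => hle k s hs)]
    refine tsum_congr fun k => ?_
    split_ifs with hk
    · have : (n : ℂ) = ℓ - k := by rw [← hk]; push_cast; ring
      rw [this]
      ring
    · ring

lemma mellin_indicator_Ioi_differentiable {h : ℝ → ℂ} {r ε : ℝ} (hr : 0 < r) (hε : 0 < ε)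
    (hcont : ContinuousOn h (Ioi 0)) (htop : h =O[atTop] fun t => Real.exp (-ε * t)) :
    Differentiable ℂ (mellin ((Ioi r).indicator h)) := by
  intro s
  -- The function vanishes near `0`, so it is `O(t ^ (-b))` for every `b`; any `b < Re s` will do.
  refine mellin_differentiableAt_of_isBigO_rpow_exp (a := ε) (b := s.re - 1) hε ?_ ?_ ?_ (by linarith)
  · have h1 : LocallyIntegrableOn h (Ioi 0) := hcont.locallyIntegrableOn measurableSet_Ioi
    rw [locallyIntegrableOn_iff isOpen_Ioi.isLocallyClosed] at h1 ⊢
    exact fun k hk hk' => (h1 k hk hk').indicator measurableSet_Ioi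
  · refine htop.congr' ?_ EventuallyEq.rfl
    filter_upwards [eventually_gt_atTop r] with t ht
    rw [indicator_of_mem (show t ∈ Ioi r from ht)]
  · refine (Asymptotics.isBigO_zero _ _).congr' ?_ EventuallyEq.rfl
    filter_upwards [Ioo_mem_nhdsGT hr] with t ht
    rw [indicator_of_notMem (show t ∉ Ioi r from not_lt.2 ht.2.le)]

/-- On `(0, r]` the Laurent series is integrated term by term, dominated by `‖c k‖ r^k t^{Re s - ℓ -
1}`, which is integrable at `0` because `Re s > ℓ`. -/
lemma mellin_eq_tsum_add {c : ℕ → ℂ} {ℓ : ℕ} {h : ℝ → ℂ} {R r ε : ℝ}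
    (hc : ∀ t : ℝ, 0 < t → t < R → HasSum (fun k => c k * (t : ℂ) ^ k) ((t : ℂ) ^ ℓ * h t))
    (hcont : ContinuousOn h (Ioi 0)) (hε : 0 < ε) (htop : h =O[atTop] fun t => Real.exp (-ε * t))
    (hr : 0 < r) (hrR : r < R) {s : ℂ} (hs : (ℓ : ℝ) < s.re) :
    mellin h s = (r : ℂ) ^ (s - ℓ) * ∑' k, c k * (r : ℂ) ^ k / (s - ℓ + k) +
      mellin ((Ioi r).indicator h) s := by
  have hbot : h =O[𝓝[>] 0] fun t : ℝ => t ^ (-(ℓ : ℝ)) := by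
    have h1 := isBigO_sub_sum (hr.trans hrR) hc 0
    simp only [Finset.range_zero, Finset.sum_empty, sub_zero] at h1
    refine h1.trans (Asymptotics.IsBigO.of_bound 1 ?_)
    filter_upwards [self_mem_nhdsWithin] with t ht
    have ht : 0 < t := ht
    rw [norm_zpow, Complex.norm_real, one_mul, Real.rpow_neg ht.le, Real.rpow_natCast]
    simp
  have hconv : IntegrableOn (fun t : ℝ => (t : ℂ) ^ (s - 1) • h t) (Ioi 0) :=
    mellinConvergent_of_isBigO_rpow_exp hε (hcont.locallyIntegrableOn measurableSet_Ioi) htop hbot hs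
  have hsplit : mellin h s = (∫ t : ℝ in Ioc 0 r, (t : ℂ) ^ (s - 1) • h t) +
      ∫ t : ℝ in Ioi r, (t : ℂ) ^ (s - 1) • h t := by
    rw [mellin, ← Ioc_union_Ioi_eq_Ioi hr.le]
    exact setIntegral_union (Ioc_disjoint_Ioi le_rfl) measurableSet_Ioi
      (hconv.mono_set Ioc_subset_Ioi_self) (hconv.mono_set (Ioi_subset_Ioi hr.le))
  have hind : mellin ((Ioi r).indicator h) s = ∫ t : ℝ in Ioi r, (t : ℂ) ^ (s - 1) • h t := by
    rw [mellin]
    have : ∀ t : ℝ, (t : ℂ) ^ (s - 1) • (Ioi r).indicator h t =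
        (Ioi r).indicator (fun t : ℝ => (t : ℂ) ^ (s - 1) • h t) t := fun t => by
      by_cases ht : t ∈ Ioi r <;> simp [ht]
    simp_rw [this]
    rw [setIntegral_indicator measurableSet_Ioi, Ioi_inter_Ioi, sup_eq_right.2 hr.le]
  rw [hsplit, hind]
  congr 1
  have hu := summable_norm_of_hasSum hc hr hrR
  have hσ : -1 < (s - ℓ - 1).re := by simp; linarith
  have hF : HasSum (fun k => ∫ t : ℝ in Ioc 0 r, c k * ((t : ℂ) ^ (s - ℓ - 1) * (t : ℂ) ^ k))
      (∫ t : ℝ in Ioc 0 r, (t : ℂ) ^ (s - 1) • h t) := by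
    refine hasSum_integral_of_dominated_convergence
      (fun k t => ‖c k‖ * r ^ k * t ^ (s - ℓ - 1).re) (fun k => ?_) (fun k => ?_) ?_ ?_ ?_
    · refine ContinuousOn.aestronglyMeasurable (fun t ht => ?_) measurableSet_Ioc
      refine ContinuousAt.continuousWithinAt ?_
      refine continuousAt_const.mul (ContinuousAt.mul ?_ (by fun_prop))
      exact (Complex.continuousAt_ofReal_cpow_const t _ (Or.inr ht.1.ne'))
    · refine (ae_restrict_iff' measurableSet_Ioc).2 (Eventually.of_forall fun t ht => ?_)
      rw [norm_mul, norm_mul, Complex.norm_cpow_eq_rpow_re_of_pos ht.1, norm_pow,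
        Complex.norm_real, Real.norm_of_nonneg ht.1.le, mul_comm (t ^ _), ← mul_assoc]
      have := ht.1.le
      have := ht.2
      gcongr
    · exact Eventually.of_forall fun t => hu.mul_right _
    · simp_rw [tsum_mul_right]
      refine Integrable.const_mul ?_ _
      have := (intervalIntegral.intervalIntegrable_rpow' (a := 0) (b := r) hσ)
      rwa [intervalIntegrable_iff_integrableOn_Ioc_of_le hr.le] at this
    · refine (ae_restrict_iff' measurableSet_Ioc).2 (Eventually.of_forall fun t ht => ?_)
      have ht0 : (t : ℂ) ≠ 0 := by exact_mod_cast ht.1.ne'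
      have h1 := (hc t ht.1 (ht.2.trans_lt hrR)).mul_left ((t : ℂ) ^ (s - ℓ - 1))
      have h2 : (t : ℂ) ^ (s - ℓ - 1) * ((t : ℂ) ^ ℓ * h t) = (t : ℂ) ^ (s - 1) • h t := by
        rw [← mul_assoc, ← Complex.cpow_natCast, ← Complex.cpow_add _ _ ht0, smul_eq_mul]
        ring_nf
      rw [h2] at h1
      refine h1.congr_fun fun k => by ring
  rw [← hF.tsum_eq, ← tsum_mul_left]
  refine tsum_congr fun k => ?_
  rw [integral_const_mul]
  have hr0 : (r : ℂ) ≠ 0 := by exact_mod_cast hr.ne'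
  have h1 : ∫ t : ℝ in Ioc 0 r, (t : ℂ) ^ (s - ℓ - 1) * (t : ℂ) ^ k =
      ∫ t : ℝ in Ioc 0 r, (t : ℂ) ^ (s - ℓ + k - 1) := by
    refine setIntegral_congr_fun measurableSet_Ioc fun t ht => ?_
    have ht0 : (t : ℂ) ≠ 0 := by exact_mod_cast ht.1.ne'
    rw [← Complex.cpow_natCast, ← Complex.cpow_add _ _ ht0]
    ring_nf
  have hpos : 0 < (s - ℓ + k).re := by
    simp
    have : (0 : ℝ) ≤ k := Nat.cast_nonneg k
    linarith
  have hne : s - ℓ + k ≠ 0 := fun h0 => by rw [h0] at hpos; simp at hpos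
  rw [h1, ← intervalIntegral.integral_of_le hr.le, integral_cpow (Or.inl (by
    rw [Complex.sub_re, Complex.one_re]; linarith)), sub_add_cancel, Complex.ofReal_zero,
    Complex.zero_cpow hne, sub_zero, Complex.cpow_add _ _ hr0, Complex.cpow_natCast]
  ring

/-- The Mellin transform of a function which has a Laurent expansion at `0` and decays
exponentially extends meromorphically to the plane; its poles are simple and their residues are the
Laurent coefficients. -/
theorem exists_meromorphic_mellin {c : ℕ → ℂ} {ℓ : ℕ} {h : ℝ → ℂ} {R ε : ℝ} (hR : 0 < R)
    (hc : ∀ t : ℝ, 0 < t → t < R → HasSum (fun k => c k * (t : ℂ) ^ k) ((t : ℂ) ^ ℓ * h t))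
    (hcont : ContinuousOn h (Ioi 0)) (hε : 0 < ε)
    (htop : h =O[atTop] fun t => Real.exp (-ε * t)) :
    ∃ M : ℂ → ℂ, (∀ s, MeromorphicAt M s) ∧ (∀ s : ℂ, (ℓ : ℝ) < s.re → M s = mellin h s) ∧
      ∀ k : ℕ, ∃ G : ℂ → ℂ, AnalyticAt ℂ G (ℓ - k) ∧
        ∀ᶠ s in 𝓝[≠] ((ℓ : ℂ) - k), M s = c k / (s - (ℓ - k)) + G s := by
  set r := R / 2
  have hr : 0 < r := half_pos hR
  have hrR : r < R := half_lt_self hR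
  have hr0 : (r : ℂ) ≠ 0 := by exact_mod_cast hr.ne'
  have hJ : Differentiable ℂ (mellin ((Ioi r).indicator h)) :=
    mellin_indicator_Ioi_differentiable hr hε hcont htop
  have hpow : ∀ a : ℂ, Differentiable ℂ fun s : ℂ => (r : ℂ) ^ (s - a) := fun a s =>
    (differentiableAt_id.sub_const a).const_cpow (Or.inl hr0)
  have hu : Summable fun k => ‖c k * (r : ℂ) ^ k‖ := by
    simpa [abs_of_pos hr] using summable_norm_of_hasSum hc hr hrR
  have hU : ∀ n : ℤ, IsOpen {s : ℂ | |s.re - n| < 3 / 4} := fun n =>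
    isOpen_lt (continuous_abs.comp (Complex.continuous_re.sub continuous_const)) continuous_const
  refine ⟨fun s => (r : ℂ) ^ (s - ℓ) * ∑' k, c k * (r : ℂ) ^ k / (s - ℓ + k) +
    mellin ((Ioi r).indicator h) s, fun s => ?_, fun s hs =>
      (mellin_eq_tsum_add hc hcont hε htop hr hrR hs).symm, fun k => ?_⟩
  · obtain ⟨G, hG, hGs⟩ := exists_differentiableOn_tsum_div hu ℓ (round s.re)
    have hs : s ∈ {z : ℂ | |z.re - round s.re| < 3 / 4} :=
      (abs_sub_round s.re).trans_lt (by norm_num)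
    refine MeromorphicAt.add (MeromorphicAt.mul ((hpow ℓ).analyticAt s).meromorphicAt ?_)
      (hJ.analyticAt s).meromorphicAt
    refine MeromorphicAt.congr (f := fun z => (∑' k : ℕ, if (ℓ : ℤ) - k = round s.re then
      c k * (r : ℂ) ^ k else 0) / (z - (round s.re : ℤ)) + G z) ?_ ?_
    · refine MeromorphicAt.add (MeromorphicAt.div (MeromorphicAt.const _ _) ?_)
        (hG.analyticAt ((hU _).mem_nhds hs)).meromorphicAt
      exact (MeromorphicAt.id s).sub (MeromorphicAt.const _ _)
    · filter_upwards [mem_nhdsWithin_of_mem_nhds ((hU _).mem_nhds hs)] with z hz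
      exact (hGs z hz).symm
  · obtain ⟨G, hG, hGs⟩ := exists_differentiableOn_tsum_div hu ℓ ((ℓ : ℤ) - k)
    set z₀ : ℂ := ℓ - k
    have hz₀ : z₀ ∈ {z : ℂ | |z.re - ((ℓ : ℤ) - k : ℤ)| < 3 / 4} := by
      simp [z₀]
    -- Near `z₀ = ℓ - k` the polar part is `c k * r ^ (s - z₀) / (s - z₀)`. Splitting off the value
    -- `1` of the power at `z₀` leaves the residue `c k` and an entire difference quotient.
    have hD : Differentiable ℂ (dslope (fun s : ℂ => (r : ℂ) ^ (s - z₀)) z₀) := by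
      rw [← differentiableOn_univ, Complex.differentiableOn_dslope univ_mem]
      exact (hpow z₀).differentiableOn
    refine ⟨fun s => c k * dslope (fun s : ℂ => (r : ℂ) ^ (s - z₀)) z₀ s +
      (r : ℂ) ^ (s - ℓ) * G s + mellin ((Ioi r).indicator h) s, ?_, ?_⟩
    · exact ((analyticAt_const.mul (hD.analyticAt z₀)).add (((hpow ℓ).analyticAt z₀).mul
        (hG.analyticAt ((hU _).mem_nhds hz₀)))).add (hJ.analyticAt z₀)
    · filter_upwards [mem_nhdsWithin_of_mem_nhds ((hU _).mem_nhds hz₀), self_mem_nhdsWithin]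
        with s hs hne
      have hne : s ≠ z₀ := hne
      have hsub : s - z₀ ≠ 0 := sub_ne_zero.2 hne
      have hp : (∑' j : ℕ, if (ℓ : ℤ) - j = (ℓ : ℤ) - k then c j * (r : ℂ) ^ j else 0) =
          c k * (r : ℂ) ^ k := by
        rw [tsum_eq_single k]
        · simp
        · intro j hj
          rw [if_neg]
          omega
      have hcast : (((ℓ : ℤ) - k : ℤ) : ℂ) = z₀ := by simp [z₀]
      rw [hGs s hs, hp, hcast, dslope_of_ne _ hne, slope_def_field]
      have hz : (r : ℂ) ^ (s - z₀) = (r : ℂ) ^ (s - ℓ) * (r : ℂ) ^ k := by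
        rw [← Complex.cpow_natCast, ← Complex.cpow_add _ _ hr0]
        simp only [z₀]
        ring_nf
      rw [hz, sub_self, Complex.cpow_zero]
      field_simp
      ring

end Mellin

/-! ### Asymptotic and absolutely exact expansions -/

section Expansions

lemma hasSum_zpow_sub {c : ℕ → ℂ} {ℓ : ℕ} {x : ℂ} {t : ℝ} (ht : 0 < t)
    (hc : HasSum (fun k => c k * (t : ℂ) ^ k) ((t : ℂ) ^ ℓ * x)) :
    HasSum (fun k : ℕ => c k * (t : ℂ) ^ ((k : ℤ) - (ℓ : ℤ))) x := by
  have ht0 : (t : ℂ) ≠ 0 := by exact_mod_cast ht.ne'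
  have h := hc.mul_left (((t : ℂ) ^ ℓ)⁻¹)
  rw [inv_mul_cancel_left₀ (pow_ne_zero _ ht0)] at h
  refine h.congr_fun fun k => ?_
  rw [zpow_sub₀ ht0, zpow_natCast, zpow_natCast]
  ring

lemma isLittleO_zpow_sub (ℓ : ℕ) {m n : ℕ} (hmn : m < n) :
    (fun t : ℝ => (t : ℂ) ^ ((n : ℤ) - (ℓ : ℤ)))
      =o[𝓝[>] 0] fun t : ℝ => (t : ℂ) ^ ((m : ℤ) - (ℓ : ℤ)) := by
  have h1 : (fun t : ℝ => (t : ℂ) ^ (n - m)) =o[𝓝[>] (0 : ℝ)] fun _ => (1 : ℂ) := by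
    rw [Asymptotics.isLittleO_one_iff]
    exact tendsto_nhdsWithin_of_tendsto_nhds
      ((Complex.continuous_ofReal.pow _).tendsto' 0 0 (by simp; omega))
  have h2 := h1.mul_isBigO
    (Asymptotics.isBigO_refl (fun t : ℝ => (t : ℂ) ^ ((m : ℤ) - (ℓ : ℤ))) (𝓝[>] (0 : ℝ)))
  refine h2.congr' ?_ (by simp)
  filter_upwards [self_mem_nhdsWithin] with t ht
  have ht : 0 < t := ht
  have ht0 : (t : ℂ) ≠ 0 := by exact_mod_cast ht.ne'
  rw [← zpow_natCast, ← zpow_add₀ ht0, Nat.cast_sub hmn.le]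
  ring_nf

lemma isAsymptoticExpansion_of_hasSum {c : ℕ → ℂ} {ℓ : ℕ} {h : ℝ → ℂ} {R : ℝ} (hR : 0 < R)
    (hc : ∀ t : ℝ, 0 < t → t < R → HasSum (fun k => c k * (t : ℂ) ^ k) ((t : ℂ) ^ ℓ * h t)) :
    IsAsymptoticExpansion h (fun k t => c k * (t : ℂ) ^ ((k : ℤ) - (ℓ : ℤ)))
      (fun k t => (t : ℂ) ^ ((k : ℤ) - (ℓ : ℤ))) := by
  exact ⟨fun n => isLittleO_zpow_sub ℓ n.lt_succ_self,
    fun n => (Asymptotics.isBigO_refl _ _).const_mul_left _, fun n => isBigO_sub_sum hR hc (n + 1)⟩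

lemma isAbsolutelyExact_of_hasSum {c : ℕ → ℂ} {ℓ : ℕ} {h : ℝ → ℂ} {R : ℝ}
    (hc : ∀ t : ℝ, 0 < t → t < R → HasSum (fun k => c k * (t : ℂ) ^ k) ((t : ℂ) ^ ℓ * h t)) :
    IsAbsolutelyExact h (fun k t => c k * (t : ℂ) ^ ((k : ℤ) - (ℓ : ℤ))) R := by
  have key : ∀ x ∈ Ioo 0 R, ∃ s ∈ 𝓝[Ioo 0 R] x, s ⊆ Ioo 0 R ∧ ∃ u : ℕ → ℝ, Summable u ∧
      ∀ (k : ℕ), ∀ t ∈ s, ‖c k * (t : ℂ) ^ ((k : ℤ) - (ℓ : ℤ))‖ ≤ u k := by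
    intro x hx
    obtain ⟨r, hxr, hrR⟩ := exists_between hx.2
    have hx2 : 0 < x / 2 := half_pos hx.1
    -- M-test on `[x/2, r]`: the upper end controls `t^k`, the lower end controls `t^{-ℓ}`.
    refine ⟨Icc (x / 2) r, mem_nhdsWithin_of_mem_nhds (Icc_mem_nhds (half_lt_self hx.1) hxr),
      fun t ht => ⟨hx2.trans_le ht.1, ht.2.trans_lt hrR⟩, _,
      (summable_norm_of_hasSum hc (hx.1.trans hxr) hrR).mul_right ((x / 2) ^ ℓ)⁻¹,
      fun k t ht => ?_⟩
    have ht0 : 0 < t := hx2.trans_le ht.1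
    have ht0' : (t : ℂ) ≠ 0 := by exact_mod_cast ht0.ne'
    rw [zpow_sub₀ ht0', norm_mul, norm_div, zpow_natCast, zpow_natCast, norm_pow, norm_pow,
      Complex.norm_real, Real.norm_of_nonneg ht0.le, div_eq_mul_inv, ← mul_assoc]
    have h1 := ht.1
    have h2 := ht.2
    have hr : 0 < r := hx.1.trans hxr
    gcongr
  refine ⟨tendstoLocallyUniformlyOn_of_forall_exists_nhds fun x hx => ?_,
    fun t => ∑' k : ℕ, ‖c k * (t : ℂ) ^ ((k : ℤ) - (ℓ : ℤ))‖,
    tendstoLocallyUniformlyOn_of_forall_exists_nhds fun x hx => ?_⟩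
  · obtain ⟨s, hs, hsub, u, hu, hle⟩ := key x hx
    refine ⟨s, hs, (tendstoUniformlyOn_tsum_nat hu hle).congr_right fun t ht => ?_⟩
    exact (hasSum_zpow_sub (hsub ht).1 (hc t (hsub ht).1 (hsub ht).2)).tsum_eq
  · obtain ⟨s, hs, hsub, u, hu, hle⟩ := key x hx
    exact ⟨s, hs, tendstoUniformlyOn_tsum_nat hu fun k t ht => by
      rw [norm_norm]; exact hle k t ht⟩

end Expansions

/-! ### Linear eigenvalues with polynomial multiplicities -/

section PolynomialSpectrum

open Polynomial in
lemma summable_eval_div_rpow (B : Polynomial ℝ) {a β σ : ℝ} (ha : 0 < a) (hβ : 0 < β)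
    (hσ : ((1 + B.natDegree : ℕ) : ℝ) < σ) :
    Summable fun n : ℕ => ‖((B.eval (n : ℝ) : ℝ) : ℂ)‖ / (a * (n + β)) ^ σ := by
  have hσ0 : 0 < σ := lt_of_le_of_lt (Nat.cast_nonneg _) hσ
  have h1 : (fun n : ℕ => B.eval (n : ℝ)) =O[atTop] fun n : ℕ => (n : ℝ) ^ B.natDegree := by
    have := (isBigO_atTop_of_degree_le B (X ^ B.natDegree)
      (by rw [degree_X_pow]; exact degree_le_natDegree)).comp_tendsto
        (tendsto_natCast_atTop_atTop (R := ℝ))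
    simpa [Function.comp_def] using this
  have h2 : (fun n : ℕ => ((a * (n + β)) ^ σ)⁻¹) =O[atTop] fun n : ℕ => ((n : ℝ) ^ σ)⁻¹ := by
    refine Asymptotics.IsBigO.of_bound (a ^ σ)⁻¹ ?_
    filter_upwards [eventually_gt_atTop 0] with n hn
    have hn : (0 : ℝ) < n := by exact_mod_cast hn
    rw [Real.norm_of_nonneg (by positivity), Real.norm_of_nonneg (by positivity), ← mul_inv,
      ← Real.mul_rpow ha.le hn.le]
    gcongr
    linarith
  refine summable_of_isBigO_nat (g := fun n : ℕ => (n : ℝ) ^ ((B.natDegree : ℝ) - σ)) ?_ ?_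
  · rw [Real.summable_nat_rpow]
    push_cast at hσ
    linarith
  · refine ((h1.norm_left).mul h2).congr' ?_ ?_
    · exact Eventually.of_forall fun n => by simp [div_eq_mul_inv]
    · filter_upwards [eventually_gt_atTop 0] with n hn
      have hn : (0 : ℝ) < n := by exact_mod_cast hn
      rw [Real.rpow_sub hn, Real.rpow_natCast, div_eq_mul_inv]

variable {H : Type u} [NormedAddCommGroup H] [InnerProductSpace ℂ H] [CompleteSpace H]

/-- The heat trace and the truncated zeta function of an operator with linear eigenvalues and
polynomial multiplicities. -/
theorem exists_zetaContinuation (P : H →ₗ.[ℂ] H) (a α : ℝ) (A B : Polynomial ℝ) (N : ℕ)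
    (ha : 0 < a) (hαN : 0 < α + N)
    (hA : A = Polynomial.C a * (Polynomial.X + Polynomial.C α))
    (hP : HasPolynomialSpectrum P A B) :
    (∀ t : ℝ, 0 < t → IsTraceClass (heatOperator P t)) ∧
    (∀ t : ℝ, 0 < t → HasSum (fun n : ℕ => ((B.eval ((n + N : ℕ) : ℝ) : ℝ) : ℂ) *
      (Real.exp (-(t * A.eval ((n + N : ℕ) : ℝ))) : ℝ)) (heatTrace P t -
        ∑ n ∈ Finset.range N, (B.eval (n : ℝ) * Real.exp (-(t * A.eval (n : ℝ))) : ℝ))) ∧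
    ∃ (Z : ℂ → ℂ) (c : ℕ → ℂ), IsZetaContinuation P (A.eval (N : ℝ)) (1 + B.natDegree) Z ∧
      (∀ (k : ℕ) (t : ℝ), expansionTerm Z (1 + B.natDegree) k t =
        c k * (t : ℂ) ^ ((k : ℤ) - ((1 + B.natDegree : ℕ) : ℤ))) ∧
      ∀ t : ℝ, 0 < t → t < 2 * Real.pi / a → HasSum (fun k => c k * (t : ℂ) ^ k)
        ((t : ℂ) ^ (1 + B.natDegree) * (heatTrace P t -
          ∑ n ∈ Finset.range N, (B.eval (n : ℝ) * Real.exp (-(t * A.eval (n : ℝ))) : ℝ))) := by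
  have hAe : ∀ x : ℝ, A.eval x = a * (x + α) := fun x => by simp [hA]
  have hinj : Function.Injective fun n : ℕ => A.eval (n : ℝ) := by
    intro m n h
    simp only [hAe] at h
    have := mul_left_cancel₀ ha.ne' h
    exact_mod_cast add_right_cancel this
  set d := B.natDegree
  -- Shifting the index by `N` makes the truncated sum start at `0` with positive offset `β`; the
  -- degree of the multiplicity polynomial, hence `ℓ`, is unchanged.
  set β : ℝ := N + α with hβdef
  have hβ : 0 < β := by linarith
  set B' : Polynomial ℝ := B.comp (Polynomial.X + Polynomial.C (N : ℝ))
  have hB'd : B'.natDegree = d := by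
    rw [Polynomial.natDegree_comp, Polynomial.natDegree_X_add_C, mul_one]
  have hB'e : ∀ n : ℕ, B'.eval (n : ℝ) = B.eval ((n + N : ℕ) : ℝ) := fun n => by simp [B']
  have hAβ : ∀ n : ℕ, A.eval ((n + N : ℕ) : ℝ) = a * (n + β) := fun n => by
    rw [hAe]; push_cast; ring
  obtain ⟨b, hb⟩ := exists_eval_eq_sum_choose d B' hB'd.le
  set h : ℝ → ℂ := fun t => expRational b d a β t
  have hsum : ∀ t : ℝ, 0 < t → HasSum (fun n : ℕ => ((B.eval ((n + N : ℕ) : ℝ) : ℝ) : ℂ) *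
      (Real.exp (-(t * A.eval ((n + N : ℕ) : ℝ))) : ℝ)) (h t) := by
    intro t ht
    refine (hasSum_expRational b d ha ht).congr_fun fun n => ?_
    rw [← hB'e, hb, hAβ]
  have htr : ∀ t : ℝ, 0 < t → HasTrace (heatOperator P t)
      (∑' n : ℕ, (Real.exp (-(t * A.eval (n : ℝ))) : ℂ) * (B.eval (n : ℝ) : ℝ)) := by
    intro t ht
    refine hasTrace_functionOf hP hinj (fun μ => (Real.exp (-(t * μ)) : ℂ)) ?_
    rw [← summable_nat_add_iff N]
    refine (hsum t ht).summable.norm.congr fun n => ?_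
    rw [mul_comm]
  have hheat : ∀ t : ℝ, 0 < t → heatTrace P t -
      ((∑ n ∈ Finset.range N, B.eval (n : ℝ) * Real.exp (-(t * A.eval (n : ℝ))) : ℝ) : ℂ) =
        h t := by
    intro t ht
    rw [Complex.ofReal_sum]
    have hs : Summable fun n : ℕ =>
        ((B.eval (n : ℝ) * Real.exp (-(t * A.eval (n : ℝ))) : ℝ) : ℂ) := by
      rw [← summable_nat_add_iff N]
      refine (hsum t ht).summable.congr fun n => ?_
      push_cast
      rfl
    rw [heatTrace, trace_eq_of_hasTrace (htr t ht), ← (hsum t ht).tsum_eq, sub_eq_iff_eq_add']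
    refine Eq.trans ?_ (hs.sum_add_tsum_nat_add N).symm |>.trans ?_
    · refine tsum_congr fun n => ?_
      push_cast
      ring
    · congr 1
      refine tsum_congr fun n => ?_
      push_cast
      rfl
  have hcont : ContinuousOn h (Ioi 0) := continuousOn_expRational b d β ha
  obtain ⟨c, hc⟩ := exists_hasSum_expRational b d β ha
  have hR : 0 < 2 * Real.pi / a := by positivity
  have hc' : ∀ t : ℝ, 0 < t → t < 2 * Real.pi / a →
      HasSum (fun k => c k * (t : ℂ) ^ k) ((t : ℂ) ^ (1 + d) * h t) := by
    intro t ht htR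
    rw [add_comm 1 d]
    exact hc t (by simpa [abs_of_pos ht] using htR) (by exact_mod_cast ht.ne')
  obtain ⟨M, hM, hMe, hMp⟩ := exists_meromorphic_mellin hR hc' hcont (mul_pos ha hβ)
    (expRational_isBigO b d β ha)
  have hzeta : ∀ s : ℂ, ((1 + d : ℕ) : ℝ) < s.re →
      HasTrace (truncatedPower P (A.eval (N : ℝ)) s) (M s * (Complex.Gamma s)⁻¹) := by
    intro s hs
    have hs0 : 0 < s.re := lt_of_le_of_lt (Nat.cast_nonneg _) hs
    have hpos : ∀ n : ℕ, 0 < a * (n + β) := fun n => by positivity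
    have hsumm : Summable fun n : ℕ =>
        ‖((B.eval ((n + N : ℕ) : ℝ) : ℝ) : ℂ)‖ / (a * (n + β)) ^ s.re := by
      have := summable_eval_div_rpow B' ha hβ (σ := s.re) (by rw [hB'd]; exact hs)
      simpa only [hB'e] using this
    have hmel := hasSum_mellin (a := fun n : ℕ => ((B.eval ((n + N : ℕ) : ℝ) : ℝ) : ℂ))
      (p := fun n : ℕ => a * (n + β)) (F := h) (fun n => Or.inr (hpos n)) hs0 (by
        intro t ht
        refine (hsum t ht).congr_fun fun n => ?_
        rw [hAβ, neg_mul, mul_comm t]) hsumm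
    have hΓ : Complex.Gamma s ≠ 0 := Complex.Gamma_ne_zero_of_re_pos hs0
    set f : ℝ → ℂ := fun μ => if A.eval (N : ℝ) ≤ μ then (μ : ℂ) ^ (-s) else 0
    have hf : ∀ n : ℕ, f (A.eval ((n + N : ℕ) : ℝ)) * (B.eval ((n + N : ℕ) : ℝ) : ℝ) =
        ((B.eval ((n + N : ℕ) : ℝ) : ℝ) : ℂ) / ((a * (n + β) : ℝ) : ℂ) ^ s := by
      intro n
      have hle : A.eval (N : ℝ) ≤ A.eval ((n + N : ℕ) : ℝ) := by
        rw [hAe, hAe]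
        push_cast
        have : (0 : ℝ) ≤ n := Nat.cast_nonneg n
        nlinarith
      simp only [f, if_pos hle]
      rw [hAβ, Complex.cpow_neg, div_eq_mul_inv, mul_comm]
    -- `A` is strictly increasing, so the cut-off at `A(N)` removes exactly the indices `n < N`.
    have hf0 : ∀ n ∈ Finset.range N, f (A.eval (n : ℝ)) * (B.eval (n : ℝ) : ℝ) = 0 := by
      intro n hn
      have hlt : A.eval (n : ℝ) < A.eval (N : ℝ) := by
        rw [hAe, hAe]
        have : (n : ℝ) < N := by exact_mod_cast Finset.mem_range.1 hn
        nlinarith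
      simp [f, not_le.2 hlt]
    have hfs : Summable fun n : ℕ => ‖f (A.eval (n : ℝ)) * (B.eval (n : ℝ) : ℝ)‖ := by
      rw [← summable_nat_add_iff N]
      refine hsumm.congr fun n => ?_
      rw [hf, norm_div, Complex.norm_cpow_eq_rpow_re_of_pos (hpos n)]
    have ht := hasTrace_functionOf hP hinj f hfs
    have hval : ∑' n : ℕ, f (A.eval (n : ℝ)) * (B.eval (n : ℝ) : ℝ) =
        M s * (Complex.Gamma s)⁻¹ := by
      rw [← hfs.of_norm.sum_add_tsum_nat_add N, Finset.sum_eq_zero hf0, zero_add, hMe s hs,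
        ← hmel.tsum_eq, ← tsum_mul_right]
      refine tsum_congr fun n => ?_
      rw [hf]
      field_simp
    rw [hval] at ht
    exact ht
  refine ⟨fun t ht => ⟨_, htr t ht⟩, fun t ht => by rw [hheat t ht]; exact hsum t ht,
    -- `1 / Γ` is entire; at the poles of `Γ` the default value `0` agrees with its zeros.
    fun s => M s * (Complex.Gamma s)⁻¹, c,
    ⟨fun s => (hM s).mul (Complex.differentiable_one_div_Gamma.analyticAt s).meromorphicAt,
      fun s hs => ⟨_, hzeta s hs⟩, fun s hs => (trace_eq_of_hasTrace (hzeta s hs)).symm⟩,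
    fun k t => ?_, fun t ht htR => by rw [hheat t ht]; exact hc' t ht htR⟩
  obtain ⟨G, hG, hMG⟩ := hMp k
  rw [expansionTerm, residue_eq hG]
  filter_upwards [hMG, self_mem_nhdsWithin,
    mem_nhdsWithin_of_mem_nhds (Metric.ball_mem_nhds _ one_pos)] with s hs hne hball
  rw [← hs]
  -- `Γ * Γ⁻¹ = 1` fails only at the integers `-m`, and a punctured unit disc around the integer `ℓ
  -- - k` contains none.
  have hΓ : Complex.Gamma s ≠ 0 := by
    refine Complex.Gamma_ne_zero fun m hm => hne ?_
    rw [hm, Metric.mem_ball, dist_eq_norm] at hball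
    have h1 : (-(m : ℂ) - (((1 + d : ℕ) : ℂ) - k)) = ((-(m : ℤ) - ((1 + d : ℕ) - k) : ℤ) : ℂ) := by
      push_cast; ring
    rw [h1, Complex.norm_intCast] at hball
    have h2 : |(-(m : ℤ) - (((1 + d : ℕ) : ℤ) - k) : ℤ)| < 1 := by exact_mod_cast hball
    rw [Int.abs_lt_one_iff] at h2
    rw [h2, Int.cast_zero, sub_eq_zero] at h1
    rw [mem_singleton_iff, hm, h1]
  field_simp

end PolynomialSpectrum

/-! ### Bernoulli numbers -/

section Bernoulli

/-- Once the earlier coefficients vanish, the remainder estimate reads `‖w n‖ t^n ≤ C t^{n + 1}`;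
divide by `t^n` and let `t ↓ 0`. -/
lemma eq_zero_of_hasSum_pow {w : ℕ → ℂ} {R : ℝ} (hR : 0 < R)
    (hw : ∀ t : ℝ, 0 < t → t < R → HasSum (fun k => w k * (t : ℂ) ^ k) 0) (n : ℕ) : w n = 0 := by
  induction n using Nat.strong_induction_on with
  | _ n ih =>
    have hw' : ∀ t : ℝ, 0 < t → t < R →
        HasSum (fun k => w k * (t : ℂ) ^ k) ((t : ℂ) ^ 0 * (fun _ => 0 : ℝ → ℂ) t) := by
      simpa using hw
    have hle : ∀ᶠ t in 𝓝[>] (0 : ℝ), ‖w n‖ ≤ (∑' k, ‖w (k + (n + 1))‖ * (R / 2) ^ k) * t := by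
      filter_upwards [Ioo_mem_nhdsGT (half_pos hR)] with t ht
      have h1 := norm_sub_sum_le hw' (half_lt_self hR) ht.1 ht.2.le (n + 1)
      rw [Finset.sum_range_succ, Finset.sum_eq_zero fun k hk => by
        rw [ih k (Finset.mem_range.1 hk), zero_mul]] at h1
      simp only [mul_zero, zero_add, zero_sub, norm_neg, norm_mul, norm_pow, Complex.norm_real,
        Real.norm_of_nonneg ht.1.le] at h1
      rw [pow_succ', ← mul_assoc] at h1
      exact le_of_mul_le_mul_right h1 (pow_pos ht.1 n)
    have hlim : Tendsto (fun t : ℝ => (∑' k, ‖w (k + (n + 1))‖ * (R / 2) ^ k) * t) (𝓝[>] 0)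
        (𝓝 0) := by
      refine tendsto_nhdsWithin_of_tendsto_nhds ?_
      exact (continuous_const.mul continuous_id).tendsto' _ _ (by simp)
    exact norm_le_zero_iff.1 (ge_of_tendsto hlim hle)

/-- The Taylor coefficients of `t / (exp t - 1)` are the numbers `bernoulli k / k!`. -/
lemma eq_bernoulli_of_hasSum {c : ℕ → ℂ} {R : ℝ} (hR : 0 < R)
    (hc : ∀ t : ℝ, 0 < t → t < R → HasSum (fun k => c k * (t : ℂ) ^ k)
      ((t : ℂ) / (Complex.exp t - 1))) (k : ℕ) :
    c k = ((bernoulli k : ℚ) : ℂ) / ((k.factorial : ℕ) : ℂ) := by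
  set e : ℕ → ℂ := fun k => PowerSeries.coeff k (PowerSeries.exp ℂ - 1)
  have he : ∀ t : ℂ, HasSum (fun k => e k * t ^ k) (Complex.exp t - 1) := by
    intro t
    have h1 : HasSum (fun k : ℕ => t ^ k / (k.factorial : ℂ)) (Complex.exp t) := by
      rw [Complex.exp_eq_exp_ℂ]
      exact NormedSpace.expSeries_div_hasSum_exp t
    have h2 : HasSum (fun k : ℕ => if k = 0 then (1 : ℂ) else 0) 1 := by
      simpa using hasSum_ite_eq (0 : ℕ) (1 : ℂ)
    refine (h1.sub h2).congr_fun fun k => ?_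
    simp only [e, map_sub, PowerSeries.coeff_exp, PowerSeries.coeff_one]
    split_ifs with hk
    · simp [hk]
    · simp
      ring
  -- The Cauchy product converts the analytic identity into one of formal power series, where the
  -- nonzero factor `exp - 1` can be cancelled against the Bernoulli generating series.
  have hmul : PowerSeries.mk c * (PowerSeries.exp ℂ - 1) = PowerSeries.X := by
    rw [← sub_eq_zero]
    ext n
    simp only [map_zero]
    refine eq_zero_of_hasSum_pow (w := fun n => PowerSeries.coeff n
      (PowerSeries.mk c * (PowerSeries.exp ℂ - 1) - PowerSeries.X)) hR (fun t ht htR => ?_) n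
    have h1 := hc t ht htR
    have h2 := he t
    have h3 := hasSum_sum_range_mul_of_summable_norm h1.summable.norm h2.summable.norm
    rw [h1.tsum_eq, h2.tsum_eq, div_mul_cancel₀] at h3
    · have h4 : HasSum (fun n : ℕ => if n = 1 then (t : ℂ) else 0) t := hasSum_ite_eq 1 (t : ℂ)
      have h5 := h3.sub h4
      rw [sub_self] at h5
      refine h5.congr_fun fun m => ?_
      rw [map_sub, PowerSeries.coeff_mul, Finset.Nat.sum_antidiagonal_eq_sum_range_succ_mk, sub_mul,
        Finset.sum_mul, PowerSeries.coeff_X]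
      congr 1
      · refine Finset.sum_congr rfl fun i hi => ?_
        have him : i ≤ m := Nat.lt_succ_iff.1 (Finset.mem_range.1 hi)
        simp only [PowerSeries.coeff_mk, e]
        rw [← Nat.add_sub_cancel' him, pow_add, Nat.add_sub_cancel_left]
        ring
      · split_ifs with hm <;> simp [hm]
    · have : (1 : ℝ) < Real.exp t := Real.one_lt_exp_iff.2 ht
      rw [sub_ne_zero]
      exact_mod_cast this.ne'
  have hne : PowerSeries.exp ℂ - 1 ≠ 0 := by
    intro h0
    rw [h0, mul_zero] at hmul
    exact PowerSeries.X_ne_zero hmul.symm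
  have h := mul_right_cancel₀ hne (hmul.trans (bernoulliPowerSeries_mul_exp_sub_one ℂ).symm)
  have h' := congrArg (PowerSeries.coeff k) h
  simp only [PowerSeries.coeff_mk, bernoulliPowerSeries] at h'
  rw [h']
  simp

/-- By Euler's formula a zero would force `∑ 1 / n^{2k} = 0`, although the term `n = 1` is `1`. The
reduced terms form an asymptotic scale because of this. -/
lemma bernoulli_two_mul_ne_zero {k : ℕ} (hk : k ≠ 0) : bernoulli (2 * k) ≠ 0 := by
  intro h0
  have h := hasSum_zeta_nat hk
  rw [h0] at h
  simp only [Rat.cast_zero, mul_zero, zero_div] at h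
  have h1 := le_hasSum h 1 fun n _ => by positivity
  norm_num at h1

/-- The number of terms of `∑ k, bernoulli k / k! * t ^ (k - 1)` which make up the first `n` of its
nonvanishing terms. -/
def bernoulliIndex : ℕ → ℕ
  | 0 => 0
  | 1 => 1
  | n + 2 => 2 * n + 2

lemma bernoulliIndex_strictMono : StrictMono bernoulliIndex := by
  refine strictMono_nat_of_lt_succ fun n => ?_
  rcases n with _ | _ | n <;> simp [bernoulliIndex]

/-- From `n = 2` on, each step of `bernoulliIndex` adds one surviving term and one zero term. -/
lemma sum_range_bernoulliIndex {E : Type*} [AddCommMonoid E] {f g : ℕ → E} (h0 : f 0 = g 0)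
    (h1 : f 1 = g 1) (h2 : ∀ n, f (2 * n + 2) = g (n + 2)) (h3 : ∀ n, f (2 * n + 3) = 0) (n : ℕ) :
    ∑ k ∈ Finset.range (bernoulliIndex n), f k = ∑ k ∈ Finset.range n, g k := by
  rcases n with _ | _ | n
  · simp [bernoulliIndex]
  · simp [bernoulliIndex, h0]
  · induction n with
    | zero => simp [bernoulliIndex, Finset.sum_range_succ, h0, h1]
    | succ n ih =>
      have : bernoulliIndex (n + 1 + 1 + 1) = bernoulliIndex (n + 1 + 1) + 1 + 1 := by
        simp [bernoulliIndex]
        ring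
      rw [Finset.sum_range_succ g, ← ih, this, Finset.sum_range_succ, Finset.sum_range_succ]
      simp [bernoulliIndex, h2, h3]

lemma TendstoLocallyUniformlyOn.comp_tendsto {X Y ι κ : Type*} [TopologicalSpace X]
    [UniformSpace Y] {F : ι → X → Y} {f : X → Y} {p : Filter ι} {q : Filter κ} {s : Set X}
    (h : TendstoLocallyUniformlyOn F f p s) {σ : κ → ι} (hσ : Tendsto σ q p) :
    TendstoLocallyUniformlyOn (fun i => F (σ i)) f q s := fun u hu x hx => by
  obtain ⟨v, hv, hF⟩ := h u hu x hx
  exact ⟨v, hv, hσ.eventually hF⟩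

end Bernoulli

end HeatTrace

/-! ### The theorem -/

theorem mainTheorem6 {H : Type u} [NormedAddCommGroup H] [InnerProductSpace ℂ H]
    [CompleteSpace H] :
    -- the general case of linear eigenvalues `a (n + α)` and polynomial multiplicities `B n`
    (∀ (P : H →ₗ.[ℂ] H) (a α : ℝ) (A B : Polynomial ℝ) (N : ℕ),
      HeatTrace.IsPositiveWithCompactResolvent P → 0 < a → 0 ≤ α → 0 < α + N →
      A = Polynomial.C a * (Polynomial.X + Polynomial.C α) →
      HeatTrace.HasPolynomialSpectrum P A B →
      (∀ t : ℝ, 0 < t → HeatTrace.IsTraceClass (HeatTrace.heatOperator P t)) ∧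
      ∃ Z : ℂ → ℂ, HeatTrace.IsZetaContinuation P (A.eval (N : ℝ)) (1 + B.natDegree) Z ∧
        HeatTrace.IsAsymptoticExpansion
          (fun t => HeatTrace.heatTrace P t -
            ∑ n ∈ Finset.range N, (B.eval (n : ℝ) * Real.exp (-(t * A.eval (n : ℝ))) : ℝ))
          (HeatTrace.expansionTerm Z (1 + B.natDegree))
          (fun k t => (t : ℂ) ^ ((k : ℤ) - ((1 + B.natDegree : ℕ) : ℤ))) ∧
        HeatTrace.IsAbsolutelyExact
          (fun t => HeatTrace.heatTrace P t -
            ∑ n ∈ Finset.range N, (B.eval (n : ℝ) * Real.exp (-(t * A.eval (n : ℝ))) : ℝ))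
          (HeatTrace.expansionTerm Z (1 + B.natDegree)) (2 * Real.pi / a)) ∧
    -- the operator `P₀` with the eigenvalues `1, 2, 3, …`, each of multiplicity one
    (∀ P₀ : H →ₗ.[ℂ] H,
      HeatTrace.IsPositiveWithCompactResolvent P₀ →
      HeatTrace.HasPolynomialSpectrum P₀ (Polynomial.X + Polynomial.C 1) 1 →
      (∃ Z : ℂ → ℂ, HeatTrace.IsZetaContinuation P₀ 1 1 Z ∧
        ∀ t : ℝ, 0 < t →
          HeatTrace.expansionTerm Z 1 0 t = HeatTrace.bernoulliTerm 0 t ∧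
          HeatTrace.expansionTerm Z 1 1 t = HeatTrace.bernoulliTerm 1 t ∧
          ∀ n : ℕ,
            HeatTrace.expansionTerm Z 1 (2 * n + 2) t = HeatTrace.bernoulliTerm (n + 2) t ∧
            HeatTrace.expansionTerm Z 1 (2 * n + 3) t = 0) ∧
      HeatTrace.IsAsymptoticExpansion (HeatTrace.heatTrace P₀)
        HeatTrace.bernoulliTerm HeatTrace.bernoulliTerm ∧
      HeatTrace.IsAbsolutelyExact (HeatTrace.heatTrace P₀)
        HeatTrace.bernoulliTerm (2 * Real.pi) ∧
      ∀ t : ℝ, 0 < t → t < 2 * Real.pi →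
        HasSum
          (fun n : ℕ => ((bernoulli (2 * n + 2) : ℚ) : ℂ) /
            ((Nat.factorial (2 * n + 2) : ℕ) : ℂ) * (t : ℂ) ^ (2 * n + 1))
          (HeatTrace.heatTrace P₀ t - ((t : ℂ)⁻¹ - 1 / 2))) := by
  refine ⟨fun P a α A B N _ ha _ hαN hA hP => ?_, fun P₀ _ hP => ?_⟩
  · obtain ⟨htr, -, Z, c, hZ, hterm, hc⟩ :=
      HeatTrace.exists_zetaContinuation P a α A B N ha hαN hA hP
    have hR : 0 < 2 * Real.pi / a := by positivity
    have hfun : HeatTrace.expansionTerm Z (1 + B.natDegree) =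
        fun k (t : ℝ) => c k * (t : ℂ) ^ ((k : ℤ) - ((1 + B.natDegree : ℕ) : ℤ)) := by
      funext k t
      exact hterm k t
    refine ⟨htr, Z, hZ, ?_, ?_⟩ <;> rw [hfun]
    · exact HeatTrace.isAsymptoticExpansion_of_hasSum hR hc
    · exact HeatTrace.isAbsolutelyExact_of_hasSum hc
  · obtain ⟨-, hheat, Z, c, hZ, hterm, hc⟩ :=
      HeatTrace.exists_zetaContinuation P₀ 1 1 _ _ 0 one_pos (by simp) (by simp) hP
    have hR : (0 : ℝ) < 2 * Real.pi := by positivity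
    simp only [Polynomial.natDegree_one, add_zero, Finset.range_zero, Finset.sum_empty,
      Complex.ofReal_zero, sub_zero, div_one, Polynomial.eval_one, Polynomial.eval_add,
      Polynomial.eval_X, Polynomial.eval_C, Nat.cast_zero, zero_add, Nat.cast_one] at hheat hZ hterm hc
    -- The geometric series gives `e^{-t} / (1 - e^{-t}) = 1 / (e^t - 1)`.
    have hval : ∀ t : ℝ, 0 < t →
        (t : ℂ) ^ 1 * HeatTrace.heatTrace P₀ t = (t : ℂ) / (Complex.exp t - 1) := by
      intro t ht
      have hlt : ‖Complex.exp (-t)‖ < 1 := by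
        rw [Complex.norm_exp]
        simpa using ht
      have h1 := (hasSum_geometric_of_norm_lt_one hlt).mul_left (Complex.exp (-t))
      have h2 : HasSum (fun n : ℕ => Complex.exp (-t) * Complex.exp (-t) ^ n)
          (HeatTrace.heatTrace P₀ t) := by
        refine (hheat t ht).congr_fun fun n => ?_
        push_cast
        rw [one_mul, ← Complex.exp_nat_mul, ← Complex.exp_add]
        ring_nf
      have h3 : Complex.exp t - 1 ≠ 0 := by
        have : (1 : ℝ) < Real.exp t := Real.one_lt_exp_iff.2 ht
        rw [sub_ne_zero]
        exact_mod_cast this.ne'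
      have h4 := Complex.exp_ne_zero (t : ℂ)
      rw [h2.unique h1, Complex.exp_neg, pow_one]
      have h5 : 1 - (Complex.exp t)⁻¹ = (Complex.exp t - 1) / Complex.exp t := by
        field_simp
      rw [h5]
      field_simp
    have hcb : ∀ k, c k = ((bernoulli k : ℚ) : ℂ) / ((k.factorial : ℕ) : ℂ) :=
      HeatTrace.eq_bernoulli_of_hasSum hR fun t ht htR => by
        rw [← hval t ht]
        exact hc t ht htR
    set φ : ℕ → ℝ → ℂ := fun k t => c k * (t : ℂ) ^ ((k : ℤ) - ((1 : ℕ) : ℤ))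
    have h0 : φ 0 = HeatTrace.bernoulliTerm 0 := by
      funext t
      simp [φ, hcb, HeatTrace.bernoulliTerm]
    have h1 : φ 1 = HeatTrace.bernoulliTerm 1 := by
      funext t
      simp [φ, hcb, HeatTrace.bernoulliTerm]
    have h2 : ∀ n, φ (2 * n + 2) = HeatTrace.bernoulliTerm (n + 2) := by
      intro n
      funext t
      have : (((2 * n + 2 : ℕ) : ℤ) - ((1 : ℕ) : ℤ)) = ((2 * n + 1 : ℕ) : ℤ) := by
        push_cast; ring
      simp only [φ, hcb, HeatTrace.bernoulliTerm, this, zpow_natCast]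
    have h3 : ∀ n, φ (2 * n + 3) = 0 := by
      intro n
      funext t
      have : bernoulli (2 * n + 3) = 0 :=
        bernoulli_eq_zero_of_odd ⟨n + 1, by ring⟩ (by omega)
      simp [φ, hcb, this]
    have hasym := HeatTrace.isAsymptoticExpansion_of_hasSum hR hc
    have hexact := HeatTrace.isAbsolutelyExact_of_hasSum hc
    have hB : ∀ n, ((bernoulli (2 * n + 2) : ℚ) : ℂ) / (((2 * n + 2).factorial : ℕ) : ℂ) ≠ 0 :=
      fun n => div_ne_zero (by
        exact_mod_cast HeatTrace.bernoulli_two_mul_ne_zero (Nat.succ_ne_zero n))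
        (by exact_mod_cast (Nat.factorial_pos _).ne')
    -- `bernoulliIndex n` is also the position of the `n`-th surviving term. Its coefficient is
    -- nonzero, so remainders measured in powers of `t` are measured by the first omitted term.
    have hscale : ∀ n, (fun t : ℝ => (t : ℂ) ^ ((HeatTrace.bernoulliIndex n : ℤ) - ((1 : ℕ) : ℤ)))
        =Θ[𝓝[>] 0] HeatTrace.bernoulliTerm n := by
      intro n
      have aux : ∀ k, c k ≠ 0 → (fun t : ℝ => (t : ℂ) ^ ((k : ℤ) - ((1 : ℕ) : ℤ)))
          =Θ[𝓝[>] 0] φ k := fun k hk =>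
        ((Asymptotics.isTheta_const_mul_left hk).2 Asymptotics.isTheta_rfl).symm
      rcases n with _ | _ | n
      · rw [← h0]
        exact aux 0 (by simp [hcb])
      · rw [← h1]
        exact aux 1 (by simp [hcb])
      · rw [← h2]
        exact aux (2 * n + 2) (by rw [hcb]; exact hB n)
    refine ⟨⟨Z, hZ, fun t ht => ?_⟩, ⟨fun n => ?_, fun n => Asymptotics.isBigO_refl _ _,
      fun n => ?_⟩, ⟨?_, ?_⟩, fun t ht htR => ?_⟩
    · have hφ : ∀ k, HeatTrace.expansionTerm Z 1 k t = φ k t := fun k => hterm k t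
      simp only [hφ, h0, h1, h2, h3, Pi.zero_apply, and_self, implies_true]
    · refine ((hscale (n + 1)).symm.trans_isLittleO ?_).trans_isTheta (hscale n)
      have hlt : HeatTrace.bernoulliIndex n < HeatTrace.bernoulliIndex (n + 1) :=
        HeatTrace.bernoulliIndex_strictMono n.lt_succ_self
      exact HeatTrace.isLittleO_zpow_sub 1 hlt
    · have h4 : (fun t => HeatTrace.heatTrace P₀ t -
          ∑ k ∈ Finset.range (n + 1), HeatTrace.bernoulliTerm k t) =
          fun t => HeatTrace.heatTrace P₀ t -
            ∑ k ∈ Finset.range (HeatTrace.bernoulliIndex (n + 1)), φ k t := by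
        funext t
        rw [HeatTrace.sum_range_bernoulliIndex (f := fun k => φ k t)
          (g := fun k => HeatTrace.bernoulliTerm k t) (congrFun h0 t) (congrFun h1 t)
          (fun n => congrFun (h2 n) t) (fun n => congrFun (h3 n) t)]
      rw [h4]
      exact (HeatTrace.isBigO_sub_sum hR hc _).trans_isTheta (hscale (n + 1))
    · refine (TendstoLocallyUniformlyOn.congr (HeatTrace.TendstoLocallyUniformlyOn.comp_tendsto
        hexact.1 HeatTrace.bernoulliIndex_strictMono.tendsto_atTop) fun n t _ => ?_)
      exact HeatTrace.sum_range_bernoulliIndex (f := fun k => φ k t)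
          (g := fun k => HeatTrace.bernoulliTerm k t) (congrFun h0 t) (congrFun h1 t)
          (fun n => congrFun (h2 n) t) (fun n => congrFun (h3 n) t) n
    · obtain ⟨G, hG⟩ := hexact.2
      refine ⟨G, TendstoLocallyUniformlyOn.congr (HeatTrace.TendstoLocallyUniformlyOn.comp_tendsto
        hG HeatTrace.bernoulliIndex_strictMono.tendsto_atTop) fun n t _ => ?_⟩
      exact HeatTrace.sum_range_bernoulliIndex (f := fun k => ‖φ k t‖)
          (g := fun k => ‖HeatTrace.bernoulliTerm k t‖) (by simp only [h0]) (by simp only [h1])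
          (fun n => by simp only [h2]) (fun n => by simp [h3]) n
    · have h6 := HeatTrace.hasSum_zpow_sub ht (hc t ht htR)
      have h7 := (hasSum_nat_add_iff' 2).2 h6
      have h8 : ∑ i ∈ Finset.range 2, c i * (t : ℂ) ^ ((i : ℤ) - ((1 : ℕ) : ℤ)) =
          (t : ℂ)⁻¹ - 1 / 2 := by
        rw [Finset.sum_range_succ, Finset.sum_range_one]
        refine (congrArg₂ (· + ·) (congrFun h0 t) (congrFun h1 t)).trans ?_
        simp only [HeatTrace.bernoulliTerm]
        ring
      rw [h8] at h7
      -- With the first two terms removed, the term at an odd offset is some `φ (2 * m + 3) = 0`, so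
      -- only even offsets matter.
      have hinj : Function.Injective fun n : ℕ => 2 * n := fun m n h => by
        simpa using h
      refine ((hinj.hasSum_iff fun k hk => ?_).2 h7).congr_fun fun n => ?_
      · have hodd : Odd k := by
          rw [← Nat.not_even_iff_odd]
          rintro ⟨m, rfl⟩
          exact hk ⟨m, by simp; ring⟩
        obtain ⟨m, rfl⟩ := hodd
        exact congrFun (h3 m) t
      · exact (congrFun (h2 n) t).symm
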